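/- **Conventions.** A small C*-category $\mathcal C$ has Banach Hom-spaces $\mathcal C_{AB}=\mathrm{Hom}(B;A)$, bilinear composition $\mathcal C_{AB}\times\mathcal C_{BC}\to\mathcal C_{AC}$, identities $\iota_A$ and a conjugate-linear involution $\mathcal C_{AB}\to\mathcal C_{BA}$, with $\|x\circ y\|\le\|x\|\|y\|$, $\|x^*\circ x\|=\|x\|^2$ and $x^*\circ x$ positive. It is commutative if all the C*-algebras $\mathcal C_{AA}$ are; no fullness is required. The category $\mathfrak A$ has as objects the small commutative C*-categories, and as morphisms the (linear, unital) $*$-functors $\phi:\mathcal C\to\mathcal D$ that are bijective on objects and non-degenerate: for every linear $*$-functor $\omega:\mathcal D\to\mathbb C$ and all $A,B$, $\omega|_{\mathcal D_{\phi(A)\phi(B)}}\ne0$ implies $(\omega\circ\phi)|_{\mathcal C_{AB}}\neq 0$. A *non-full spaceoid* is a saturated unital Fell line-bundle $\pi:\mathcal E\to\mathcal X$ (with Banach bundle of Fell type: continuous norm) over a topological groupoid $\mathcal X$ that is fibered by a continuous functor $\theta$ over the discrete pair groupoid $\mathcal O\times\mathcal O$ of a discrete set $\mathcal O$, such that the fibres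 $\mathcal X_{AA}$ are compact Hausdorff and consist of identities, and the source and target maps $\mathcal X_{AB}\to\mathcal X_{BB}$, $\mathcal X_{AB}\to\mathcal X_{AA}$ are homeomorphisms onto open subsets. A *morphism* $(f,F):\mathcal E^1\to\mathcal E^2$ of spaceoids consists of a continuous functor $f:\mathcal X^1\to\mathcal X^2$ over the isomorphism of pair groupoids given by a bijection $\mathcal O^1\to\mathcal O^2$, converging at infinity (for every compact $K\subset\mathcal X^2_{f(A)f(B)}$ there is a compact $L\subset\mathcal X^1_{AB}$ with $f(\mathcal X^1_{AB}\setminus L)\cap K=\varnothing$), and of a continuous fibre-preserving fibrewise linear $*$-functor $F:f^\bullet(\mathcal E^2)\to\mathcal E^1$ vanishing at infinity (for all $A,B$, $\epsilon>0$ and compact $K\subset\mathcal X^1_{AB}$ there are $\delta>0$ and a compact $L\subset\mathcal X^1_{AB}$ such that $p\in\mathcal X^1_{AB}\setminus L$, $e\in\mathcal E^2_{f(p)}$, $\|e\|<\delta$ imply $p\notin K$ and $\|F(p,e)\|<\epsilon$). With composition $(f,F)\circ(g,G)=(f\circ g,\ (p,e)\mapsto G(p,F(g(p),e)))$ these form a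 category $\mathfrak T$. **Construction.** Let $\mathcal C\in\mathfrak A$. Let $[\mathcal C;\mathbb C]$ be the set of linear $*$-functors $\omega:\mathcal C\to\mathbb C$, with the topology of pointwise convergence on all morphisms of $\mathcal C$. For objects $A,B$ let $[\omega]_{AB}$ be the class of $\omega$ for the relation "$\omega|_{\mathcal C_{AB}}$ and $\rho|_{\mathcal C_{AB}}$ differ by a factor of modulus one", let $\mathcal B_{AB}$ be the quotient space of these classes, and let $\mathcal X_{AB}=\{[\omega]_{AB}\in\mathcal B_{AB}:\dim(\mathcal C_{AB}/\ker(\omega)_{AB})=1\}$. Let $\mathcal X^{\mathcal C}=\biguplus_{A,B}\mathcal X_{AB}$, with source $[\omega]_{AB}\mapsto[\omega]_{BB}$, target $[\omega]_{AB}\mapsto[\omega]_{AA}$, composition $[\omega]_{AB}\circ[\omega]_{BC}=[\omega]_{AC}$ and inverse $[\omega]_{AB}^*=[\omega]_{BA}$. Let $\mathcal E^{\mathcal C}$ be the bundle over $\mathcal X^{\mathcal C}$ with fibre $\mathcal C_{AB}/\ker(\omega)_{AB}$ (quotient norm) over $[\omega]_{AB}$, with the operations induced by those of $\mathcal C$ and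 with the tubular topology generated by the sets $\{e:\pi(e)\in O,\ \|e-(x+\ker(\omega)_{AB})\|<\epsilon \text{ where } \pi(e)=[\omega]_{AB}\}$, for $x\in\mathcal C_{AB}$, $\epsilon>0$, $O\subset\mathcal X_{AB}$ open. Put $\Sigma(\mathcal C)=(\mathcal E^{\mathcal C},\pi,\mathcal X^{\mathcal C})$. For $\phi:\mathcal C\to\mathcal D$ in $\mathfrak A$ let $\Sigma_\phi=(\lambda^\phi,\Lambda^\phi):\Sigma(\mathcal D)\to\Sigma(\mathcal C)$, where $\lambda^\phi$ acts on objects as the inverse of $\phi$, $\lambda^\phi([\omega]_{\phi(A)\phi(B)})=[\omega\circ\phi]_{AB}$, and $\Lambda^\phi$ maps $x+\ker(\omega\circ\phi)_{AB}$ in the fibre over $[\omega\circ\phi]_{AB}$ to $\phi(x)+\ker(\omega)_{\phi(A)\phi(B)}$ in the fibre over $[\omega]_{\phi(A)\phi(B)}$. **Proposition.** For every small commutative C*-category $\mathcal C$, $\Sigma(\mathcal C)$ is a non-full spaceoid; for every morphism $\phi:\mathcal C\to\mathcal D$ of $\mathfrak A$, $\Sigma_\phi$ is a morphism of non-full spaceoids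 $\Sigma(\mathcal D)\to\Sigma(\mathcal C)$; and $\Sigma$ is a contravariant functor $\mathfrak A\to\mathfrak T$. -/

import Mathlib

open CategoryTheory Topology Bundle Opposite

universe u v w

set_option linter.checkUnivs false
set_option linter.unusedVariables false

noncomputable section

/- Part 1: C*-categories, and the category of small commutative C*-categories -/

/-- Positivity of an element `a` of a unital complex `*`-algebra `V`, given by its multiplication,
unit and involution: `a` is self-adjoint and its spectrum consists of nonnegative real numbers. -/
def IsPositiveIn {V : Type*} [AddCommGroup V] [Module ℂ V] (mul : V → V → V) (one : V)
    (star : V → V) (a : V) : Prop :=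
  star a = a ∧
    ∀ z : ℂ, (¬ ∃ b : V, mul (z • one - a) b = one ∧ mul b (z • one - a) = one) →
      0 ≤ z.re ∧ z.im = 0

/-- A small (unital) C*-category. `Hom A B` is the Hom-set `𝒞_{AB}` of morphisms with source `B`
and target `A`, and `comp x y` is `x ∘ y`. -/
structure CStarCat where
  Obj : Type u
  Hom : Obj → Obj → Type v
  [normed : ∀ A B, NormedAddCommGroup (Hom A B)]
  [space : ∀ A B, NormedSpace ℂ (Hom A B)]
  [complete : ∀ A B, CompleteSpace (Hom A B)]
  one : ∀ A, Hom A A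
  comp : ∀ {A B C}, Hom A B → Hom B C → Hom A C
  star : ∀ {A B}, Hom A B → Hom B A
  assoc : ∀ {A B C D} (x : Hom A B) (y : Hom B C) (z : Hom C D),
    comp (comp x y) z = comp x (comp y z)
  one_comp : ∀ {A B} (x : Hom A B), comp (one A) x = x
  comp_one : ∀ {A B} (x : Hom A B), comp x (one B) = x
  add_comp : ∀ {A B C} (x x' : Hom A B) (y : Hom B C), comp (x + x') y = comp x y + comp x' y
  comp_add : ∀ {A B C} (x : Hom A B) (y y' : Hom B C), comp x (y + y') = comp x y + comp x y'
  smul_comp : ∀ {A B C} (z : ℂ) (x : Hom A B) (y : Hom B C), comp (z • x) y = z • comp x y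
  comp_smul : ∀ {A B C} (z : ℂ) (x : Hom A B) (y : Hom B C), comp x (z • y) = z • comp x y
  star_star : ∀ {A B} (x : Hom A B), star (star x) = x
  star_one : ∀ A, star (one A) = one A
  star_comp : ∀ {A B C} (x : Hom A B) (y : Hom B C), star (comp x y) = comp (star y) (star x)
  star_add : ∀ {A B} (x y : Hom A B), star (x + y) = star x + star y
  star_smul : ∀ {A B} (z : ℂ) (x : Hom A B), star (z • x) = (starRingEnd ℂ z) • star x
  norm_comp_le : ∀ {A B C} (x : Hom A B) (y : Hom B C), ‖comp x y‖ ≤ ‖x‖ * ‖y‖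
  norm_star_comp : ∀ {A B} (x : Hom A B), ‖comp (star x) x‖ = ‖x‖ ^ 2
  star_comp_pos : ∀ {A B} (x : Hom A B), IsPositiveIn (comp (A := B) (B := B) (C := B)) (one B)
    (star (A := B) (B := B)) (comp (star x) x)

attribute [instance] CStarCat.normed CStarCat.space CStarCat.complete

/-- A small commutative (non-necessarily full) C*-category: all the C*-algebras `𝒞_{AA}` are
commutative. -/
structure CommCStarCat extends CStarCat.{u, v} where
  comm : ∀ {A} (x y : Hom A A), comp x y = comp y x

/-- The set `[𝒞; ℂ]` of the `ℂ`-linear `*`-functors from a C*-category to `ℂ` (a C*-category with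
one object). They are unital, as all functors are. -/
structure Character (C : CStarCat.{u, v}) where
  toFun : ∀ {A B}, C.Hom A B →ₗ[ℂ] ℂ
  map_one : ∀ A, toFun (C.one A) = 1
  map_comp : ∀ {A B D} (x : C.Hom A B) (y : C.Hom B D), toFun (C.comp x y) = toFun x * toFun y
  map_star : ∀ {A B} (x : C.Hom A B), toFun (C.star x) = starRingEnd ℂ (toFun x)

/-- An object-bijective (`ℂ`-linear) `*`-functor between C*-categories. -/
@[ext]
structure StarFunctor (C D : CStarCat.{u, v}) where
  obj : C.Obj ≃ D.Obj
  map : ∀ {A B}, C.Hom A B →ₗ[ℂ] D.Hom (obj A) (obj B)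
  map_one : ∀ A, map (C.one A) = D.one (obj A)
  map_comp : ∀ {A B E} (x : C.Hom A B) (y : C.Hom B E),
    map (C.comp x y) = D.comp (map x) (map y)
  map_star : ∀ {A B} (x : C.Hom A B), map (C.star x) = D.star (map x)

/-- The pull-back `ω ∘ φ` of a `*`-functor `ω : 𝒟 → ℂ` along a `*`-functor `φ : 𝒞 → 𝒟`. -/
def Character.pullback {C D : CStarCat.{u, v}} (ω : Character D) (φ : StarFunctor C D) :
    Character C where
  toFun := ω.toFun.comp φ.map
  map_one A := by simp [φ.map_one, ω.map_one]
  map_comp x y := by simp [φ.map_comp, ω.map_comp]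
  map_star x := by simp [φ.map_star, ω.map_star]

namespace StarFunctor

/-- Non-degeneracy: `ω|_{𝒟_{φ(A)φ(B)}} ≠ 0` implies `(ω ∘ φ)|_{𝒞_{AB}} ≠ 0`. -/
def IsNondegenerate {C D : CStarCat.{u, v}} (φ : StarFunctor C D) : Prop :=
  ∀ (ω : Character D) (A B : C.Obj),
    (ω.toFun (A := φ.obj A) (B := φ.obj B)) ≠ 0 → ((ω.pullback φ).toFun (A := A) (B := B)) ≠ 0

/-- The identity `*`-functor. -/
def refl (C : CStarCat.{u, v}) : StarFunctor C C where
  obj := Equiv.refl _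
  map := LinearMap.id
  map_one _ := rfl
  map_comp _ _ := rfl
  map_star _ := rfl

/-- The composition `φ` followed by `ψ`. -/
def trans {C D E : CStarCat.{u, v}} (φ : StarFunctor C D) (ψ : StarFunctor D E) :
    StarFunctor C E where
  obj := φ.obj.trans ψ.obj
  map := ψ.map.comp φ.map
  map_one A := (congrArg ψ.map (φ.map_one A)).trans (ψ.map_one _)
  map_comp x y := (congrArg ψ.map (φ.map_comp x y)).trans (ψ.map_comp _ _)
  map_star x := (congrArg ψ.map (φ.map_star x)).trans (ψ.map_star _)

end StarFunctor

/-- The category of small commutative C*-categories, with the object-bijective non-degenerate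
`*`-functors as morphisms. -/
instance : Category CommCStarCat.{u, v} where
  Hom C D := {φ : StarFunctor C.toCStarCat D.toCStarCat // φ.IsNondegenerate}
  id C := ⟨StarFunctor.refl _, fun _ _ _ h => h⟩
  comp φ ψ := ⟨φ.1.trans ψ.1, fun ω A B h =>
    φ.2 (ω.pullback ψ.1) A B (ψ.2 ω (φ.1.obj A) (φ.1.obj B) h)⟩

/- Part 2: Banach bundles, Fell bundles over groupoids, and spaceoids -/

/-- `E → X` is a (Fell type) Banach bundle, for a topology on the total space of the family
`E` of seminormed spaces. The fibre model `ℂ` in `TotalSpace ℂ E` is a phantom parameter;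
`TotalSpace (ℂ × ℂ) (E ×ᵇ E)` is the fibre product `E ×_X E`, with the topology of a subspace of
the product. -/
structure IsBanachBundle {X : Type*} [TopologicalSpace X] (E : X → Type*)
    [∀ p, SeminormedAddCommGroup (E p)] [∀ p, NormedSpace ℂ (E p)]
    [TopologicalSpace (TotalSpace ℂ E)] : Prop where
  continuous_proj : Continuous (TotalSpace.proj : TotalSpace ℂ E → X)
  surjective_proj : Function.Surjective (TotalSpace.proj : TotalSpace ℂ E → X)
  isOpenMap_proj : IsOpenMap (TotalSpace.proj : TotalSpace ℂ E → X)
  /-- The fibres are normed spaces... -/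
  eq_zero_of_norm : ∀ p (e : E p), ‖e‖ = 0 → e = 0
  /-- ... and they are complete. -/
  complete : ∀ p, CompleteSpace (E p)
  continuous_add : Continuous
    (fun e : TotalSpace (ℂ × ℂ) (E ×ᵇ E) => (⟨e.proj, e.snd.1 + e.snd.2⟩ : TotalSpace ℂ E))
  continuous_smul : Continuous
    (fun e : ℂ × TotalSpace ℂ E => (⟨e.2.proj, e.1 • e.2.snd⟩ : TotalSpace ℂ E))
  continuous_zero : Continuous (fun p : X => (⟨p, 0⟩ : TotalSpace ℂ E))
  continuous_norm : Continuous (fun e : TotalSpace ℂ E => ‖e.snd‖)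
  /-- The norm topology of each fibre is the subspace topology. -/
  isInducing_fibre : ∀ p, IsInducing (fun e : E p => (⟨p, e⟩ : TotalSpace ℂ E))
  /-- The tubular neighbourhoods of zero are a base of neighbourhoods of zero. -/
  tubular : ∀ (p : X), ∀ U ∈ 𝓝 (⟨p, 0⟩ : TotalSpace ℂ E), ∃ ε > 0, ∃ O : Set X, IsOpen O ∧ p ∈ O ∧
    {e : TotalSpace ℂ E | e.proj ∈ O ∧ ‖e.snd‖ < ε} ⊆ U

/-- Every point of the total space is in the range of a continuous section. -/
def IsSectionSaturated {X : Type*} [TopologicalSpace X] (E : X → Type*)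
    [TopologicalSpace (TotalSpace ℂ E)] : Prop :=
  ∀ e : TotalSpace ℂ E, ∃ σ : ∀ p, E p,
    Continuous (fun p => (⟨p, σ p⟩ : TotalSpace ℂ E)) ∧ σ e.proj = e.snd

/-- The raw data (operations and topologies, without axioms) of a Fell bundle over a groupoid `X`
fibered over the discrete pair groupoid `Ob × Ob` of a set `Ob`. As the pair groupoid is discrete,
the space `X` is the disjoint union of its fibres `X A B = X_{AB}`, and the total space of the
bundle is the disjoint union of the parts over the `X_{AB}`. An object of `X` is identified with
its identity arrow, that belongs to some `X A A`; so `src p`, `tgt p` are the identity arrows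
composable with `p` on the right and on the left. -/
structure SpaceoidData where
  Ob : Type u
  X : Ob → Ob → Type w
  [topX : ∀ A B, TopologicalSpace (X A B)]
  src : ∀ {A B}, X A B → X B B
  tgt : ∀ {A B}, X A B → X A A
  /-- The composition `p ∘ q`. -/
  comp : ∀ {A B C} (p : X A B) (q : X B C), src p = tgt q → X A C
  inv : ∀ {A B}, X A B → X B A
  /-- The fibres of the bundle. -/
  E : ∀ A B, X A B → Type v
  [seminormed : ∀ A B p, SeminormedAddCommGroup (E A B p)]
  [space : ∀ A B p, NormedSpace ℂ (E A B p)]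
  [topE : ∀ A B, TopologicalSpace (TotalSpace ℂ (E A B))]
  one : ∀ {A} (p : X A A), E A A p
  mul : ∀ {A B C} {p : X A B} {q : X B C} (h : src p = tgt q),
    E A B p → E B C q → E A C (comp p q h)
  star : ∀ {A B} {p : X A B}, E A B p → E B A (inv p)

namespace SpaceoidData

attribute [instance] topX seminormed space topE

/-- An element of a fibre, as an element of the total space. Equalities between elements of
fibres over points of the base that are equal, but not by definition, are stated in the total
space. -/
abbrev tot (S : SpaceoidData.{u, v, w}) {A B : S.Ob} {p : S.X A B} (e : S.E A B p) :
    TotalSpace ℂ (S.E A B) := ⟨p, e⟩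

/-- The base is a topological groupoid, the `X_{AA}` are compact Hausdorff spaces of identities
and the source and target maps are homeomorphisms onto open subsets. -/
structure IsBase (S : SpaceoidData.{u, v, w}) : Prop where
  src_self : ∀ {A} (p : S.X A A), S.src p = p
  tgt_self : ∀ {A} (p : S.X A A), S.tgt p = p
  src_comp : ∀ {A B C} (p : S.X A B) (q : S.X B C) (h : S.src p = S.tgt q),
    S.src (S.comp p q h) = S.src q
  tgt_comp : ∀ {A B C} (p : S.X A B) (q : S.X B C) (h : S.src p = S.tgt q),
    S.tgt (S.comp p q h) = S.tgt p
  assoc : ∀ {A B C D} (p : S.X A B) (q : S.X B C) (r : S.X C D)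
    (h₁ : S.src p = S.tgt q) (h₂ : S.src q = S.tgt r)
    (h₃ : S.src (S.comp p q h₁) = S.tgt r) (h₄ : S.src p = S.tgt (S.comp q r h₂)),
    S.comp (S.comp p q h₁) r h₃ = S.comp p (S.comp q r h₂) h₄
  tgt_comp_self : ∀ {A B} (p : S.X A B) (h : S.src (S.tgt p) = S.tgt p), S.comp (S.tgt p) p h = p
  comp_src_self : ∀ {A B} (p : S.X A B) (h : S.src p = S.tgt (S.src p)), S.comp p (S.src p) h = p
  src_inv : ∀ {A B} (p : S.X A B), S.src (S.inv p) = S.tgt p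
  tgt_inv : ∀ {A B} (p : S.X A B), S.tgt (S.inv p) = S.src p
  comp_inv : ∀ {A B} (p : S.X A B) (h : S.src p = S.tgt (S.inv p)), S.comp p (S.inv p) h = S.tgt p
  inv_comp : ∀ {A B} (p : S.X A B) (h : S.src (S.inv p) = S.tgt p), S.comp (S.inv p) p h = S.src p
  continuous_comp : ∀ A B C, Continuous
    (fun pq : {pq : S.X A B × S.X B C // S.src pq.1 = S.tgt pq.2} => S.comp pq.1.1 pq.1.2 pq.2)
  continuous_inv : ∀ A B, Continuous (S.inv : S.X A B → S.X B A)
  compactSpace : ∀ A, CompactSpace (S.X A A)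
  t2Space : ∀ A, T2Space (S.X A A)
  isOpenEmbedding_src : ∀ A B, IsOpenEmbedding (S.src : S.X A B → S.X B B)
  isOpenEmbedding_tgt : ∀ A B, IsOpenEmbedding (S.tgt : S.X A B → S.X A A)

/-- Positivity of an element of the C*-algebra `E_p`, where `p` is an identity of the groupoid:
the element is self-adjoint and its spectrum consists of nonnegative real numbers. -/
def IsPositive (S : SpaceoidData.{u, v, w}) {A : S.Ob} {p : S.X A A} (h : S.src p = S.tgt p)
    (a : S.E A A p) : Prop :=
  S.tot (S.star a) = S.tot a ∧
    ∀ z : ℂ, (¬ ∃ b : S.E A A p, S.tot (S.mul h (z • S.one p - a) b) = S.tot (S.one p) ∧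
      S.tot (S.mul h b (z • S.one p - a)) = S.tot (S.one p)) → 0 ≤ z.re ∧ z.im = 0

/-- The data are a non-full spaceoid: a saturated unital Fell line-bundle over a non-full base
spaceoid. -/
structure IsSpaceoid (S : SpaceoidData.{u, v, w}) : Prop extends IsBase S where
  isBanachBundle : ∀ A B, IsBanachBundle (S.E A B)
  /-- Saturation, in the sense of sections. -/
  isSectionSaturated : ∀ A B, IsSectionSaturated (S.E A B)
  /-- Saturation, in the sense of Fell bundles. -/
  span_mul : ∀ {A B C} (p : S.X A B) (q : S.X B C) (h : S.src p = S.tgt q),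
    Submodule.span ℂ {g | ∃ (e : S.E A B p) (f : S.E B C q), g = S.mul h e f} = ⊤
  /-- The fibres are one-dimensional. -/
  rank_one : ∀ {A B} (p : S.X A B), Module.finrank ℂ (S.E A B p) = 1
  add_mul : ∀ {A B C} {p : S.X A B} {q : S.X B C} (h : S.src p = S.tgt q)
    (e e' : S.E A B p) (f : S.E B C q), S.mul h (e + e') f = S.mul h e f + S.mul h e' f
  mul_add : ∀ {A B C} {p : S.X A B} {q : S.X B C} (h : S.src p = S.tgt q)
    (e : S.E A B p) (f f' : S.E B C q), S.mul h e (f + f') = S.mul h e f + S.mul h e f'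
  smul_mul : ∀ {A B C} {p : S.X A B} {q : S.X B C} (h : S.src p = S.tgt q) (z : ℂ)
    (e : S.E A B p) (f : S.E B C q), S.mul h (z • e) f = z • S.mul h e f
  mul_smul : ∀ {A B C} {p : S.X A B} {q : S.X B C} (h : S.src p = S.tgt q) (z : ℂ)
    (e : S.E A B p) (f : S.E B C q), S.mul h e (z • f) = z • S.mul h e f
  mul_assoc : ∀ {A B C D} {p : S.X A B} {q : S.X B C} {r : S.X C D}
    (h₁ : S.src p = S.tgt q) (h₂ : S.src q = S.tgt r)
    (h₃ : S.src (S.comp p q h₁) = S.tgt r) (h₄ : S.src p = S.tgt (S.comp q r h₂))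
    (e : S.E A B p) (f : S.E B C q) (g : S.E C D r),
    S.tot (S.mul h₃ (S.mul h₁ e f) g) = S.tot (S.mul h₄ e (S.mul h₂ f g))
  one_mul : ∀ {A B} {p : S.X A B} (h : S.src (S.tgt p) = S.tgt p) (e : S.E A B p),
    S.tot (S.mul h (S.one (S.tgt p)) e) = S.tot e
  mul_one : ∀ {A B} {p : S.X A B} (h : S.src p = S.tgt (S.src p)) (e : S.E A B p),
    S.tot (S.mul h e (S.one (S.src p))) = S.tot e
  star_add : ∀ {A B} {p : S.X A B} (e f : S.E A B p), S.star (e + f) = S.star e + S.star f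
  star_smul : ∀ {A B} {p : S.X A B} (z : ℂ) (e : S.E A B p),
    S.star (z • e) = (starRingEnd ℂ z) • S.star e
  star_star : ∀ {A B} {p : S.X A B} (e : S.E A B p), S.tot (S.star (S.star e)) = S.tot e
  star_one : ∀ {A} (p : S.X A A), S.tot (S.star (S.one p)) = S.tot (S.one p)
  star_mul : ∀ {A B C} {p : S.X A B} {q : S.X B C} (h : S.src p = S.tgt q)
    (h' : S.src (S.inv q) = S.tgt (S.inv p)) (e : S.E A B p) (f : S.E B C q),
    S.tot (S.star (S.mul h e f)) = S.tot (S.mul h' (S.star f) (S.star e))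
  continuous_mul : ∀ A B C, Continuous
    (fun ef : {ef : TotalSpace ℂ (S.E A B) × TotalSpace ℂ (S.E B C) //
      S.src ef.1.proj = S.tgt ef.2.proj} => S.tot (S.mul ef.2 ef.1.1.snd ef.1.2.snd))
  continuous_star : ∀ A B, Continuous (fun e : TotalSpace ℂ (S.E A B) => S.tot (S.star e.snd))
  continuous_one : ∀ A, Continuous (fun p : S.X A A => S.tot (S.one p))
  norm_mul_le : ∀ {A B C} {p : S.X A B} {q : S.X B C} (h : S.src p = S.tgt q)
    (e : S.E A B p) (f : S.E B C q), ‖S.mul h e f‖ ≤ ‖e‖ * ‖f‖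
  norm_star_mul : ∀ {A B} {p : S.X A B} (h : S.src (S.inv p) = S.tgt p) (e : S.E A B p),
    ‖S.mul h (S.star e) e‖ = ‖e‖ ^ 2
  star_mul_pos : ∀ {A B} {p : S.X A B} (h : S.src (S.inv p) = S.tgt p)
    (h' : S.src (S.comp (S.inv p) p h) = S.tgt (S.comp (S.inv p) p h)) (e : S.E A B p),
    S.IsPositive h' (S.mul h (S.star e) e)

/-- The raw data of a morphism `(f, F)` from `S` to `T`. `obj` is the inverse of the bijection
`f_ℛ⁰ : Ob S → Ob T`, `base` is `f_X`, and `fib p : T_{f(p)} → S_p` is the restriction of `F` to the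
fibre over `p` of the pull-back bundle. -/
@[ext]
structure HomData (S T : SpaceoidData.{u, v, w}) where
  obj : T.Ob ≃ S.Ob
  base : ∀ {A B : T.Ob}, S.X (obj A) (obj B) → T.X A B
  fib : ∀ {A B : T.Ob} (p : S.X (obj A) (obj B)), T.E A B (base p) →ₗ[ℂ] S.E (obj A) (obj B) p

namespace HomData

/-- The data `(f, F)` are a morphism of non-full spaceoids. The space
`TotalSpace ℂ (f.base *ᵖ (T.E A B))` is the part over `(A, B)` of the total space of the pull-back
bundle, with the topology of a subspace of the product. -/
structure IsMorphism {S T : SpaceoidData.{u, v, w}} (f : HomData S T) : Prop where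
  continuous_base : ∀ A B, Continuous (f.base (A := A) (B := B))
  base_src : ∀ {A B} (p : S.X (f.obj A) (f.obj B)), f.base (S.src p) = T.src (f.base p)
  base_tgt : ∀ {A B} (p : S.X (f.obj A) (f.obj B)), f.base (S.tgt p) = T.tgt (f.base p)
  base_comp : ∀ {A B C} (p : S.X (f.obj A) (f.obj B)) (q : S.X (f.obj B) (f.obj C))
    (h : S.src p = S.tgt q) (h' : T.src (f.base p) = T.tgt (f.base q)),
    f.base (S.comp p q h) = T.comp (f.base p) (f.base q) h'
  base_inv : ∀ {A B} (p : S.X (f.obj A) (f.obj B)), f.base (S.inv p) = T.inv (f.base p)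
  /-- `f_X` converges at infinity. -/
  base_infinity : ∀ A B, ∀ K : Set (T.X A B), IsCompact K →
    ∃ L : Set (S.X (f.obj A) (f.obj B)), IsCompact L ∧ ∀ p, p ∉ L → f.base p ∉ K
  continuous_fib : ∀ A B, Continuous
    (fun e : TotalSpace ℂ (f.base (A := A) (B := B) *ᵖ (T.E A B)) => S.tot (f.fib e.proj e.snd))
  fib_one : ∀ {A} (p : S.X (f.obj A) (f.obj A)), f.fib p (T.one (f.base p)) = S.one p
  fib_mul : ∀ {A B C} (p : S.X (f.obj A) (f.obj B)) (q : S.X (f.obj B) (f.obj C))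
    (h : S.src p = S.tgt q) (h' : T.src (f.base p) = T.tgt (f.base q))
    (a : T.E A B (f.base p)) (b : T.E B C (f.base q)) (c : T.E A C (f.base (S.comp p q h))),
    T.tot c = T.tot (T.mul h' a b) → f.fib _ c = S.mul h (f.fib p a) (f.fib q b)
  fib_star : ∀ {A B} (p : S.X (f.obj A) (f.obj B)) (a : T.E A B (f.base p))
    (b : T.E B A (f.base (S.inv p))), T.tot b = T.tot (T.star a) → f.fib _ b = S.star (f.fib p a)
  /-- `F` vanishes at infinity. -/
  fib_infinity : ∀ A B, ∀ ε > 0, ∀ K : Set (S.X (f.obj A) (f.obj B)), IsCompact K →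
    ∃ δ > 0, ∃ L : Set (S.X (f.obj A) (f.obj B)), IsCompact L ∧
      ∀ p, p ∉ L → ∀ e : T.E A B (f.base p), ‖e‖ < δ → p ∉ K ∧ ‖f.fib p e‖ < ε

/-- The identity map of a fibre. -/
def idFib (S : SpaceoidData.{u, v, w}) {A B : S.Ob} (p : S.X A B) :
    S.E A B p →ₗ[ℂ] S.E A B p := LinearMap.id

/-- The identity morphism. -/
def refl (S : SpaceoidData.{u, v, w}) : HomData S S where
  obj := Equiv.refl _
  base p := p
  fib {A B} p := idFib S (A := A) (B := B) p

/-- The map `R_{f(g(p))} → T_{g(p)} → S_p` between fibres. -/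
def compFib {S T R : SpaceoidData.{u, v, w}} (g : HomData S T) (f : HomData T R) {A B : R.Ob}
    (p : S.X (g.obj (f.obj A)) (g.obj (f.obj B))) :
    R.E A B (f.base (g.base p)) →ₗ[ℂ] S.E (g.obj (f.obj A)) (g.obj (f.obj B)) p :=
  (g.fib p).comp (f.fib (g.base p))

/-- The composition `g` followed by `f`; on the fibres it is `G ∘ g^•(F)`. -/
def trans {S T R : SpaceoidData.{u, v, w}} (g : HomData S T) (f : HomData T R) : HomData S R where
  obj := f.obj.trans g.obj
  base p := f.base (g.base p)
  fib {A B} p := compFib g f (A := A) (B := B) p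

theorem isMorphism_refl (S : SpaceoidData.{u, v, w}) : (refl S).IsMorphism where
  continuous_base _ _ := continuous_id
  base_src _ := rfl
  base_tgt _ := rfl
  base_comp _ _ _ _ := rfl
  base_inv _ := rfl
  base_infinity _ _ K hK := ⟨K, hK, fun _ h => h⟩
  continuous_fib A B := Pullback.continuous_lift ℂ (S.E A B) (fun p => p)
  fib_one _ := rfl
  fib_mul p q h h' a b c hc := eq_of_heq (TotalSpace.mk.inj hc).2
  fib_star p a b hb := eq_of_heq (TotalSpace.mk.inj hb).2
  fib_infinity _ _ ε hε K hK := ⟨ε, hε, K, hK, fun _ hp _ he => ⟨hp, he⟩⟩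

theorem IsMorphism.trans {S T R : SpaceoidData.{u, v, w}} {g : HomData S T} {f : HomData T R}
    (hg : g.IsMorphism) (hf : f.IsMorphism) : (g.trans f).IsMorphism where
  continuous_base A B := (hf.continuous_base A B).comp (hg.continuous_base _ _)
  base_src p := (congrArg f.base (hg.base_src p)).trans (hf.base_src _)
  base_tgt p := (congrArg f.base (hg.base_tgt p)).trans (hf.base_tgt _)
  base_comp p q h h' := by
    have h₁ : T.src (g.base p) = T.tgt (g.base q) :=
      (hg.base_src p).symm.trans ((congrArg g.base h).trans (hg.base_tgt q))
    exact (congrArg f.base (hg.base_comp p q h h₁)).trans (hf.base_comp _ _ h₁ h')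
  base_inv p := (congrArg f.base (hg.base_inv p)).trans (hf.base_inv _)
  base_infinity A B K hK := by
    obtain ⟨L, hL, h⟩ := hf.base_infinity A B K hK
    obtain ⟨M, hM, h'⟩ := hg.base_infinity _ _ L hL
    exact ⟨M, hM, fun p hp => h _ (h' p hp)⟩
  continuous_fib A B := by
    have h₁ : Continuous (fun e : TotalSpace ℂ
        ((fun p => f.base (A := A) (B := B) (g.base p)) *ᵖ (R.E A B)) =>
        (⟨g.base e.proj, e.snd⟩ : TotalSpace ℂ (f.base (A := A) (B := B) *ᵖ (R.E A B)))) := by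
      rw [(inducing_pullbackTotalSpaceEmbedding (F := ℂ) (E := R.E A B)
        (f.base (A := A) (B := B))).continuous_iff]
      exact ((hg.continuous_base _ _).comp (Pullback.continuous_proj ℂ _ _)).prodMk
        (Pullback.continuous_lift ℂ (R.E A B) _)
    have h₂ := (hf.continuous_fib A B).comp h₁
    have h₃ : Continuous (fun e : TotalSpace ℂ
        ((fun p => f.base (A := A) (B := B) (g.base p)) *ᵖ (R.E A B)) =>
        (⟨e.proj, f.fib (g.base e.proj) e.snd⟩ : TotalSpace ℂ
          (g.base (A := f.obj A) (B := f.obj B) *ᵖ (T.E (f.obj A) (f.obj B))))) := by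
      rw [(inducing_pullbackTotalSpaceEmbedding (F := ℂ) (E := T.E (f.obj A) (f.obj B))
        (g.base (A := f.obj A) (B := f.obj B))).continuous_iff]
      exact (Pullback.continuous_proj ℂ _ _).prodMk h₂
    exact (hg.continuous_fib _ _).comp h₃
  fib_one p := (congrArg (g.fib p) (hf.fib_one _)).trans (hg.fib_one p)
  fib_mul p q h h' a b c hc := by
    have h₁ : T.src (g.base p) = T.tgt (g.base q) :=
      (hg.base_src p).symm.trans ((congrArg g.base h).trans (hg.base_tgt q))
    refine hg.fib_mul p q h h₁ _ _ _ ?_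
    have key : ∀ (r : T.X _ _) (_ : r = T.comp (g.base p) (g.base q) h₁)
        (c : R.E _ _ (f.base r)), R.tot c = R.tot (R.mul h' a b) →
        T.tot (f.fib r c) = T.tot (T.mul h₁ (f.fib (g.base p) a) (f.fib (g.base q) b)) := by
      rintro r rfl c hc
      exact congrArg T.tot (hf.fib_mul _ _ h₁ h' a b c hc)
    exact key _ (hg.base_comp p q h h₁) c hc
  fib_star p a b hb := by
    refine hg.fib_star p _ _ ?_
    have key : ∀ (r : T.X _ _) (_ : r = T.inv (g.base p))
        (b : R.E _ _ (f.base r)), R.tot b = R.tot (R.star a) →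
        T.tot (f.fib r b) = T.tot (T.star (f.fib (g.base p) a)) := by
      rintro r rfl b hb
      exact congrArg T.tot (hf.fib_star _ a b hb)
    exact key _ (hg.base_inv p) b hb
  fib_infinity A B ε hε K hK := by
    obtain ⟨δ₁, hδ₁, L₁, hL₁, h₁⟩ := hg.fib_infinity _ _ ε hε K hK
    obtain ⟨δ₂, hδ₂, L₂, hL₂, h₂⟩ := hf.fib_infinity A B δ₁ hδ₁ ∅ isCompact_empty
    obtain ⟨L₃, hL₃, h₃⟩ := hg.base_infinity _ _ L₂ hL₂
    refine ⟨δ₂, hδ₂, L₁ ∪ L₃, hL₁.union hL₃, fun p hp e he => ?_⟩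
    exact h₁ p (fun h => hp (Or.inl h)) _ (h₂ _ (h₃ p (fun h => hp (Or.inr h))) e he).2

end HomData

end SpaceoidData

/-- A non-full spaceoid. -/
structure Spaceoid extends SpaceoidData.{u, v, w} where
  isSpaceoid : toSpaceoidData.IsSpaceoid

/-- The category of non-full spaceoids. -/
instance : Category Spaceoid.{u, v, w} where
  Hom S T := {f : SpaceoidData.HomData S.toSpaceoidData T.toSpaceoidData // f.IsMorphism}
  id S := ⟨_, SpaceoidData.HomData.isMorphism_refl S.toSpaceoidData⟩
  comp g f := ⟨g.1.trans f.1, g.2.trans f.2⟩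
  id_comp _ := rfl
  comp_id _ := rfl
  assoc _ _ _ := rfl

/- Part 3: the spectral spaceoid and the spectrum functor -/

namespace CStarCat

variable (C : CStarCat.{u, v})

/-- The weak-`*` topology of `[𝒞; ℂ]`, induced by all the evaluations at morphisms of `𝒞`. -/
instance : TopologicalSpace (Character C) :=
  TopologicalSpace.induced (fun ω (x : Σ A B, C.Hom A B) => ω.toFun x.2.2) inferInstance

/-- The torsor gauge equivalence on `𝒞_{AB}`: the restrictions of `ω` and `ρ` to `𝒞_{AB}` agree up
to multiplication by a phase. -/
def gauge (A B : C.Obj) : Setoid (Character C) where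
  r ω ρ := ∃ u : Circle, ∀ x : C.Hom A B, ρ.toFun x = u * ω.toFun x
  iseqv :=
    { refl := fun ω => ⟨1, fun x => by simp⟩
      symm := by
        rintro ω ρ ⟨u, h⟩
        exact ⟨u⁻¹, fun x => by simp [h]⟩
      trans := by
        rintro ω ρ σ ⟨u, h⟩ ⟨u', h'⟩
        exact ⟨u' * u, fun x => by simp [h, h', mul_assoc]⟩ }

/-- The quotient space `ℬ_{AB}` of `[𝒞; ℂ]`, whose points are the classes `[ω]_{AB}`. -/
def Orbit (A B : C.Obj) : Type (max u v) := Quotient (C.gauge A B)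

instance (A B : C.Obj) : TopologicalSpace (C.Orbit A B) :=
  inferInstanceAs (TopologicalSpace (Quotient (C.gauge A B)))

variable {C}

/-- The class `[ω]_{AB}`. -/
def Orbit.mk (A B : C.Obj) (ω : Character C) : C.Orbit A B := Quotient.mk (C.gauge A B) ω

/-- The kernel `ker(ω)_{AB}` as a function of `[ω]_{AB}`. -/
def Orbit.ker {A B : C.Obj} (b : C.Orbit A B) : Submodule ℂ (C.Hom A B) :=
  Quotient.lift (fun ω : Character C => LinearMap.ker (ω.toFun (A := A) (B := B)))
    (by
      rintro ω ρ ⟨u, h⟩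
      ext x
      simp [LinearMap.mem_ker, h]) b

theorem finrank_quotient_ker {A B : C.Obj} (ω : Character C) :
    Module.finrank ℂ (C.Hom A B ⧸ (Orbit.mk A B ω).ker) = 1 ↔ (ω.toFun (A := A) (B := B)) ≠ 0 := by
  have h := (LinearMap.quotKerEquivRange (ω.toFun (A := A) (B := B))).finrank_eq
  change Module.finrank ℂ (C.Hom A B ⧸ LinearMap.ker (ω.toFun (A := A) (B := B))) = 1 ↔ _
  rw [h]
  constructor
  · intro h1 h0
    rw [h0, LinearMap.range_zero, finrank_bot] at h1
    exact zero_ne_one h1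
  · intro h0
    rw [LinearMap.range_eq_top.2 (LinearMap.surjective h0), finrank_top, Module.finrank_self]

variable (C) in
/-- The Hom-space `X_{AB}` of the base groupoid of the spectrum. -/
def Spec (A B : C.Obj) : Type (max u v) :=
  {b : C.Orbit A B // Module.finrank ℂ (C.Hom A B ⧸ b.ker) = 1}

instance (A B : C.Obj) : TopologicalSpace (C.Spec A B) :=
  inferInstanceAs (TopologicalSpace {b : C.Orbit A B // _})

namespace Spec

/-- The point `[ω]_{AB}` of `X_{AB}`, for `ω` nonzero on `𝒞_{AB}`. -/
def mk {A B : C.Obj} (ω : Character C) (h : (ω.toFun (A := A) (B := B)) ≠ 0) : C.Spec A B :=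
  ⟨Orbit.mk A B ω, (finrank_quotient_ker ω).2 h⟩

theorem ind {A B : C.Obj} {P : C.Spec A B → Prop} (h : ∀ ω hω, P (mk ω hω)) (p : C.Spec A B) :
    P p := by
  obtain ⟨b, hb⟩ := p
  induction b using Quotient.inductionOn with
  | h ω => exact h ω ((finrank_quotient_ker ω).1 hb)

/-- Functions on `X_{AB}` that are defined on representatives: `lift f hf [ω]_{AB} = f ω`. -/
def lift {A B : C.Obj} {β : Type*}
    (f : ∀ ω : Character C, (ω.toFun (A := A) (B := B)) ≠ 0 → β)
    (hf : ∀ ω ρ hω hρ, (C.gauge A B).r ω ρ → f ω hω = f ρ hρ) (p : C.Spec A B) : β :=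
  Quotient.hrecOn (motive := fun b : Quotient (C.gauge A B) =>
    Module.finrank ℂ (C.Hom A B ⧸ Orbit.ker b) = 1 → β) p.1
    (fun ω h => f ω ((finrank_quotient_ker ω).1 h))
    (fun ω ρ h => Function.hfunext
      (by rw [Quotient.sound h])
      (fun _ _ _ => heq_of_eq (hf ω ρ _ _ h))) p.2

theorem lift_mk {A B : C.Obj} {β : Type*}
    (f : ∀ ω : Character C, (ω.toFun (A := A) (B := B)) ≠ 0 → β)
    (hf : ∀ ω ρ hω hρ, (C.gauge A B).r ω ρ → f ω hω = f ρ hρ) (ω hω) :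
    lift f hf (mk ω hω) = f ω hω := rfl

end Spec

theorem gauge_star {A B : C.Obj} {ω ρ : Character C} (h : (C.gauge A B).r ω ρ) :
    (C.gauge B A).r ω ρ := by
  obtain ⟨u, h⟩ := h
  refine ⟨u⁻¹, fun x => ?_⟩
  have := congrArg (starRingEnd ℂ) (h (C.star x))
  simpa only [ω.map_star, ρ.map_star, map_mul, Complex.conj_conj, Circle.coe_inv_eq_conj] using this

/-- If `[ω]_{AB} = [ρ]_{AB}` is nonzero then `ω` and `ρ` coincide on `𝒞_{AA}`. -/
theorem eq_of_gauge {A B : C.Obj} {ω ρ : Character C} (hω : (ω.toFun (A := A) (B := B)) ≠ 0)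
    (h : (C.gauge A B).r ω ρ) (a : C.Hom A A) : ω.toFun a = ρ.toFun a := by
  obtain ⟨u, h⟩ := h
  obtain ⟨x, hx⟩ : ∃ x, ω.toFun (A := A) (B := B) x ≠ 0 := by
    by_contra! h0
    exact hω (LinearMap.ext h0)
  have h1 := h (C.comp a x)
  rw [ρ.map_comp, ω.map_comp, h x] at h1
  have hu : (u : ℂ) ≠ 0 := Circle.coe_ne_zero u
  have : (ρ.toFun a - ω.toFun a) * (u * ω.toFun x) = 0 := by linear_combination h1
  rcases mul_eq_zero.1 this with h2 | h2
  · exact (sub_eq_zero.1 h2).symm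
  · exact absurd h2 (mul_ne_zero hu hx)

/-- If `ω` and `ρ` coincide on `𝒞_{AA}` then `[ω]_{AB} = [ρ]_{AB}`. -/
theorem gauge_of_eq {A : C.Obj} {ω ρ : Character C} (h : ∀ a : C.Hom A A, ω.toFun a = ρ.toFun a)
    (B : C.Obj) : (C.gauge A B).r ω ρ := by
  have key : ∀ x y : C.Hom A B, ω.toFun x * starRingEnd ℂ (ω.toFun y) =
      ρ.toFun x * starRingEnd ℂ (ρ.toFun y) := fun x y => by
    rw [← ω.map_star, ← ρ.map_star, ← ω.map_comp, ← ρ.map_comp, h]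
  by_cases h0 : ∃ x : C.Hom A B, ω.toFun x ≠ 0
  · obtain ⟨y, hy⟩ := h0
    have hn : ‖ω.toFun y‖ = ‖ρ.toFun y‖ := by
      have := congrArg norm (key y y)
      simp only [norm_mul, RCLike.norm_conj] at this
      exact (mul_self_inj (norm_nonneg _) (norm_nonneg _)).1 this
    have hy' : ρ.toFun y ≠ 0 := by
      rw [← norm_ne_zero_iff] at hy ⊢
      rwa [← hn]
    refine ⟨⟨ρ.toFun y / ω.toFun y, ?_⟩, fun x => ?_⟩
    · rw [Submonoid.unitSphere, Submonoid.mem_mk, Subsemigroup.mem_mk, mem_sphere_zero_iff_norm, norm_div, hn, div_self (norm_ne_zero_iff.2 hy')]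
    · have hc : starRingEnd ℂ (ω.toFun y) ≠ 0 := by simpa using hy
      have hc' : starRingEnd ℂ (ρ.toFun y) ≠ 0 := by simpa using hy'
      change ρ.toFun x = ρ.toFun y / ω.toFun y * ω.toFun x
      have h1 := key x y
      have h2 := key y y
      field_simp
      refine mul_right_cancel₀ hc' ?_
      linear_combination (-ω.toFun y) * h1 + ω.toFun x * h2
  · push Not at h0
    refine ⟨1, fun x => ?_⟩
    have h1 := key x x
    rw [h0 x, zero_mul, eq_comm, mul_eq_zero] at h1
    rw [h0 x, mul_zero]
    simpa using h1

theorem toFun_ne_zero_self (ω : Character C) (A : C.Obj) :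
    (ω.toFun (A := A) (B := A)) ≠ 0 := fun h => by
  have := ω.map_one A
  rw [h] at this
  exact zero_ne_one this

namespace Spec

/-- The class `[ω]_{AD}` as a function of the nonzero class `[ω]_{AB}`. -/
def extend {A B : C.Obj} (p : C.Spec A B) (D : C.Obj) : C.Orbit A D :=
  lift (fun ω _ => Orbit.mk A D ω)
    (fun _ _ hω _ h => Quotient.sound (gauge_of_eq (eq_of_gauge hω h) D)) p

/-- The target map, `[ω]_{AB} ↦ [ω]_{AA}`. -/
def tgt {A B : C.Obj} : C.Spec A B → C.Spec A A :=
  lift (fun ω _ => mk ω (toFun_ne_zero_self ω A))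
    (fun _ _ hω _ h => Subtype.ext (Quotient.sound (gauge_of_eq (eq_of_gauge hω h) A)))

/-- The involution, `[ω]_{AB} ↦ [ω]_{BA}`. -/
def inv {A B : C.Obj} : C.Spec A B → C.Spec B A :=
  lift (fun ω hω => mk ω (fun h => hω (LinearMap.ext fun x => by
      have := congrArg (fun f => f (C.star x)) h
      simpa [ω.map_star] using this)))
    (fun _ _ _ _ h => Subtype.ext (Quotient.sound (gauge_star h)))

/-- The source map, `[ω]_{AB} ↦ [ω]_{BB}`. -/
def src {A B : C.Obj} : C.Spec A B → C.Spec B B :=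
  lift (fun ω _ => mk ω (toFun_ne_zero_self ω B))
    (fun _ _ hω _ h => Subtype.ext (Quotient.sound (gauge_of_eq (eq_of_gauge (fun h0 =>
      hω (LinearMap.ext fun x => by
        have := congrArg (fun f => f (C.star x)) h0
        simpa [Character.map_star] using this)) (gauge_star h)) B)))

/-- Composable points of `X` are of the form `[ω]_{AB}` and `[ω]_{BD}`, with the same `ω`. -/
theorem ind₂ {A B D : C.Obj} {P : ∀ (p : C.Spec A B) (q : C.Spec B D), src p = tgt q → Prop}
    (H : ∀ ω hω hω' h, P (mk ω hω) (mk ω hω') h) (p : C.Spec A B) (q : C.Spec B D)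
    (h : src p = tgt q) : P p q h := by
  induction p using ind with
  | h ω hω =>
  induction q using ind with
  | h ρ hρ =>
  have h1 : (C.gauge B B).r ω ρ := Quotient.exact (congrArg Subtype.val h)
  have h2 := gauge_of_eq (eq_of_gauge (toFun_ne_zero_self ω B) h1) D
  have hω' : (ω.toFun (A := B) (B := D)) ≠ 0 := fun h0 => hρ (by
    obtain ⟨u, h2⟩ := h2
    ext x
    rw [h2 x, h0]
    simp)
  have h3 : mk ρ hρ = mk ω hω' := Subtype.ext (Quotient.sound h2).symm
  revert h
  rw [h3]
  exact H ω hω hω'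

/-- The composition, `[ω]_{AB} ∘ [ω]_{BD} = [ω]_{AD}`. -/
def comp {A B D : C.Obj} (p : C.Spec A B) (q : C.Spec B D) (h : src p = tgt q) : C.Spec A D :=
  ⟨extend p D, by
    induction p, q, h using ind₂ with
    | H ω hω hω' h =>
    refine (finrank_quotient_ker ω).2 fun h0 => ?_
    refine hω (LinearMap.ext fun x => ?_)
    obtain ⟨y, hy⟩ : ∃ y, ω.toFun (A := B) (B := D) y ≠ 0 := by
      by_contra! h0
      exact hω' (LinearMap.ext h0)
    have h1 := ω.map_comp x y
    rw [h0] at h1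
    exact (mul_eq_zero.1 h1.symm).resolve_right hy⟩

theorem comp_mk {A B D : C.Obj} (ω : Character C) (hω : (ω.toFun (A := A) (B := B)) ≠ 0)
    (hω' : (ω.toFun (A := B) (B := D)) ≠ 0) (h : src (mk ω hω) = tgt (mk ω hω')) :
    (comp (mk ω hω) (mk ω hω') h).1 = Orbit.mk A D ω := rfl

/-- The fibre `(𝒞 / ker ω)_{AB}` over `[ω]_{AB}`, with the quotient norm. -/
abbrev Fib (A B : C.Obj) (p : C.Spec A B) : Type v := C.Hom A B ⧸ p.1.ker

/-- The Gel'fand transform `[ω]_{AB} ↦ x + ker(ω)_{AB}` of `x`. -/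
def gelfand {A B : C.Obj} (x : C.Hom A B) (p : C.Spec A B) : Fib A B p := Submodule.Quotient.mk x

/-- The part over `O` of the tube of radius `ε` around the Gel'fand transform of `x`. -/
def tube {A B : C.Obj} (x : C.Hom A B) (ε : ℝ) (O : Set (C.Spec A B)) :
    Set (TotalSpace ℂ (Fib A B)) :=
  {e | e.proj ∈ O ∧ ‖e.snd - gelfand x e.proj‖ < ε}

/-- The tubular topology of the total space, generated by the tubes around Gel'fand transforms. -/
instance (A B : C.Obj) : TopologicalSpace (TotalSpace ℂ (Fib A B)) :=
  TopologicalSpace.generateFrom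
    {U | ∃ (x : C.Hom A B) (ε : ℝ) (O : Set (C.Spec A B)), 0 < ε ∧ IsOpen O ∧ U = tube x ε O}

theorem comp_mem_ker {A B D : C.Obj} (p : C.Spec A B) (q : C.Spec B D) (h : src p = tgt q)
    (x : C.Hom A B) (y : C.Hom B D) (hxy : x ∈ p.1.ker ∨ y ∈ q.1.ker) :
    C.comp x y ∈ (comp p q h).1.ker := by
  induction p, q, h using ind₂ with
  | H ω hω hω' h =>
  change ω.toFun (C.comp x y) = 0
  rw [ω.map_comp, mul_eq_zero]
  exact hxy

theorem star_mem_ker {A B : C.Obj} (p : C.Spec A B) (x : C.Hom A B) (hx : x ∈ p.1.ker) :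
    C.star x ∈ (inv p).1.ker := by
  induction p using ind with
  | h ω hω =>
  change ω.toFun (C.star x) = 0
  rw [ω.map_star, show ω.toFun x = 0 from hx, map_zero]

/-- `(x + ker ω) ∘ (y + ker ω) = x ∘ y + ker ω`. -/
def fibMul {A B D : C.Obj} {p : C.Spec A B} {q : C.Spec B D} (h : src p = tgt q) :
    Fib A B p → Fib B D q → Fib A D (comp p q h) :=
  Quotient.map₂ (sa := p.1.ker.quotientRel) (sb := q.1.ker.quotientRel)
    (sc := (comp p q h).1.ker.quotientRel) (fun x y => C.comp x y) (by
      intro x x' hx y y' hy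
      have hx' := (Submodule.quotientRel_def _).1 hx
      have hy' := (Submodule.quotientRel_def _).1 hy
      refine (Submodule.quotientRel_def _).2 ?_
      have h1 := C.add_comp (x - x') x' y
      have h2 := C.comp_add x' (y - y') y'
      rw [sub_add_cancel] at h1 h2
      have h3 : C.comp x y - C.comp x' y' = C.comp (x - x') y + C.comp x' (y - y') := by
        rw [h1, h2]; abel
      rw [h3]
      exact Submodule.add_mem _ (comp_mem_ker p q h _ _ (Or.inl hx'))
        (comp_mem_ker p q h _ _ (Or.inr hy')))

/-- `(x + ker ω)^* = x^* + ker ω`. -/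
def fibStar {A B : C.Obj} {p : C.Spec A B} : Fib A B p → Fib B A (inv p) :=
  Quotient.map (sa := p.1.ker.quotientRel) (sb := (inv p).1.ker.quotientRel)
    (fun x => C.star x) (by
      intro x x' hx
      have hx' := (Submodule.quotientRel_def _).1 hx
      refine (Submodule.quotientRel_def _).2 ?_
      have h1 := C.star_add (x - x') x'
      rw [sub_add_cancel] at h1
      have h3 : C.star x - C.star x' = C.star (x - x') := by rw [h1]; abel
      rw [h3]
      exact star_mem_ker p _ hx')

end Spec

variable (C) in
/-- The spectral spaceoid `Σ(𝒞)` of a C*-category. -/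
def spectrum : SpaceoidData.{u, v, max u v} where
  Ob := C.Obj
  X := C.Spec
  src := Spec.src
  tgt := Spec.tgt
  comp := Spec.comp
  inv := Spec.inv
  E := Spec.Fib
  one {A} p := Spec.gelfand (C.one A) p
  mul := Spec.fibMul
  star := Spec.fibStar

variable {D : CStarCat.{u, v}}

/-- The map `λ^φ : [ω]_{φ(A)φ(B)} ↦ [ω ∘ φ]_{AB}`. -/
def specMap (φ : StarFunctor C D) (hφ : φ.IsNondegenerate) {A B : C.Obj} :
    D.Spec (φ.obj A) (φ.obj B) → C.Spec A B :=
  Spec.lift (fun ω hω => Spec.mk (ω.pullback φ) (hφ ω A B hω))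
    (fun _ _ _ _ ⟨u, h⟩ => Subtype.ext (Quotient.sound ⟨u, fun x => h (φ.map x)⟩))

theorem specMap_ker_le (φ : StarFunctor C D) (hφ : φ.IsNondegenerate) {A B : C.Obj}
    (p : D.Spec (φ.obj A) (φ.obj B)) :
    (specMap φ hφ p).1.ker ≤ p.1.ker.comap φ.map := by
  induction p using Spec.ind with
  | h ω hω => exact fun x hx => hx

/-- The map `x + ker(ω ∘ φ) ↦ φ(x) + ker(ω)`. -/
def fibMap (φ : StarFunctor C D) (hφ : φ.IsNondegenerate) {A B : C.Obj}
    (p : D.Spec (φ.obj A) (φ.obj B)) :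
    Spec.Fib A B (specMap φ hφ p) →ₗ[ℂ] Spec.Fib (φ.obj A) (φ.obj B) p :=
  Submodule.mapQ _ _ φ.map (specMap_ker_le φ hφ p)

/-- The morphism `(λ^φ, Λ^φ) : Σ(𝒟) → Σ(𝒞)` associated to a non-degenerate `*`-functor
`φ : 𝒞 → 𝒟`; the map `Λ^φ` is `x + ker(ω ∘ φ) ↦ φ(x) + ker(ω)` on the fibre over `[ω]`. -/
def spectrumMap (φ : StarFunctor C D) (hφ : φ.IsNondegenerate) :
    SpaceoidData.HomData D.spectrum C.spectrum where
  obj := φ.obj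
  base := specMap φ hφ
  fib {A B} p := fibMap φ hφ (A := A) (B := B) p

end CStarCat

/-- The contravariant assignment `Σ`, on objects and on morphisms, from the category of small
commutative C*-categories to the category of non-full spaceoids, provided that it is well-defined:
that is, that each `Σ(𝒞)` is a non-full spaceoid, and each `Σ_φ` a morphism of such. -/
def spectrumPrefunctor
    (hobj : ∀ C : CommCStarCat.{u, v}, C.toCStarCat.spectrum.IsSpaceoid)
    (hmap : ∀ {C D : CommCStarCat.{u, v}} (φ : C ⟶ D),
      (CStarCat.spectrumMap φ.1 φ.2).IsMorphism) :
    CommCStarCat.{u, v}ᵒᵖ ⥤q Spaceoid.{u, v, max u v} where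
  obj C := ⟨C.unop.toCStarCat.spectrum, hobj C.unop⟩
  map φ := ⟨CStarCat.spectrumMap φ.unop.1 φ.unop.2, hmap φ.unop⟩

end

/-! Two facts about a character ω carry the theorem. First, ω on 𝒞_{AA} determines ω on 𝒞_{AB} up to
a phase, because ω(x) times the conjugate of ω(y) is ω(x ∘ y^*). Hence a point of X_{AB} is
determined by its target (`tgt_injective`), and identities in the groupoid can be checked on
targets. By the C*-identity and the contractivity of `*`-homomorphisms on 𝒞_{BB}, characters are
contractive, so they form a compact space by Tychonoff, in which being nonzero on 𝒞_{AB} is an open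
condition. Passing to quotients, X_{AA} is compact Hausdorff and X_{AB} is openly embedded in it.

Second, the quotient norm of x + ker ω is |ω(x)| (`norm_gelfand_mk`). One inequality is
contractivity; the other needs an element of the unit ball on which ω is 1, obtained by functional
calculus in x^* ∘ x, and this is where positivity enters (`Character.exists_norm_le_one`). So ω
identifies each fibre isometrically with ℂ: norms are multiplicative, the norm of a Gel'fand
transform is continuous, and tubes around one transform describe the neighbourhoods of its points
(`nhds_gelfand`). Continuity of the operations then reduces to norm estimates.

For a `*`-functor φ, the map λ^φ is proper, since ω is nonzero on 𝒟_{φ(A)φ(B)} whenever ω ∘ φ is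
nonzero on 𝒞_{AB}, and Λ^φ is isometric on fibres; this settles both conditions at infinity. The
functor laws hold on representatives. -/

noncomputable section

/-! ### The C*-algebras 𝒞_{AA} and the norm of the fibres -/

namespace CStarCat

section EndAlg

variable (C : CStarCat.{u, v}) (A : C.Obj)

/-- The C*-algebra `𝒞_{AA}`. -/
def EndAlg : Type v := C.Hom A A

instance : NormedAddCommGroup (C.EndAlg A) := inferInstanceAs (NormedAddCommGroup (C.Hom A A))
instance : NormedSpace ℂ (C.EndAlg A) := inferInstanceAs (NormedSpace ℂ (C.Hom A A))
instance : CompleteSpace (C.EndAlg A) := inferInstanceAs (CompleteSpace (C.Hom A A))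

theorem comp_zero {C : CStarCat.{u, v}} {A B D : C.Obj} (x : C.Hom A B) :
    C.comp x (0 : C.Hom B D) = 0 := by
  simpa using C.comp_smul 0 x (0 : C.Hom B D)

theorem zero_comp {C : CStarCat.{u, v}} {A B D : C.Obj} (y : C.Hom B D) :
    C.comp (0 : C.Hom A B) y = 0 := by
  simpa using C.smul_comp 0 (0 : C.Hom A B) y

instance : NormedRing (C.EndAlg A) :=
  { (inferInstance : NormedAddCommGroup (C.EndAlg A)) with
    mul := fun x y => C.comp (A := A) (B := A) (C := A) x y
    one := C.one A
    left_distrib := fun x y z => C.comp_add (A := A) (B := A) (C := A) x y z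
    right_distrib := fun x y z => C.add_comp (A := A) (B := A) (C := A) x y z
    zero_mul := fun x => zero_comp (A := A) (B := A) (D := A) x
    mul_zero := fun x => comp_zero (A := A) (B := A) (D := A) x
    mul_assoc := fun x y z => C.assoc (A := A) (B := A) (C := A) (D := A) x y z
    one_mul := fun x => C.one_comp (A := A) (B := A) x
    mul_one := fun x => C.comp_one (A := A) (B := A) x
    norm_mul_le := fun x y => C.norm_comp_le (A := A) (B := A) (C := A) x y }

instance : NormedAlgebra ℂ (C.EndAlg A) :=
  { Algebra.ofModule (R := ℂ) (A := C.EndAlg A)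
      (fun z x y => C.smul_comp (A := A) (B := A) (C := A) z x y)
      (fun z x y => C.comp_smul (A := A) (B := A) (C := A) z x y) with
    norm_smul_le := fun z x => norm_smul_le z x }

instance : StarRing (C.EndAlg A) where
  star x := C.star (A := A) (B := A) x
  star_involutive x := C.star_star (A := A) (B := A) x
  star_mul x y := C.star_comp (A := A) (B := A) (C := A) x y
  star_add x y := C.star_add (A := A) (B := A) x y

instance : CStarAlgebra (C.EndAlg A) where
  norm_mul_self_le x := by
    have h := C.norm_star_comp (A := A) (B := A) x
    rw [sq] at h
    exact h.ge
  star_smul z x := C.star_smul (A := A) (B := A) z x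

end EndAlg

variable {C : CStarCat.{u, v}}

/-- The restriction of `ω` to `𝒞_{AA}`, a `*`-homomorphism. -/
def _root_.Character.endHom (ω : Character C) (A : C.Obj) : C.EndAlg A →⋆ₐ[ℂ] ℂ where
  toFun := ω.toFun (A := A) (B := A)
  map_one' := ω.map_one A
  map_mul' x y := ω.map_comp (A := A) (B := A) (D := A) x y
  map_zero' := map_zero (ω.toFun (A := A) (B := A))
  map_add' := map_add (ω.toFun (A := A) (B := A))
  commutes' z := by
    rw [Algebra.algebraMap_eq_smul_one, Algebra.algebraMap_eq_smul_one]
    exact (map_smul (ω.toFun (A := A) (B := A)) z (C.one A)).trans (by rw [ω.map_one])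
  map_star' x := ω.map_star (A := A) (B := A) x

theorem _root_.Character.toFun_star_comp (ω : Character C) {A B : C.Obj} (x : C.Hom A B) :
    ω.toFun (C.comp (C.star x) x) = ((‖ω.toFun x‖ ^ 2 : ℝ) : ℂ) := by
  rw [ω.map_comp, ω.map_star, Complex.conj_mul', Complex.ofReal_pow]

/-- `*`-functors to `ℂ` are contractive. -/
theorem _root_.Character.norm_le (ω : Character C) {A B : C.Obj} (x : C.Hom A B) :
    ‖ω.toFun x‖ ≤ ‖x‖ := by
  -- The C*-identity moves the question to 𝒞_{BB}, where ω is a `*`-homomorphism of C*-algebras.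
  have h : ‖ω.toFun (C.comp (C.star x) x)‖ ≤ ‖C.comp (C.star x) x‖ :=
    NonUnitalStarAlgHom.norm_apply_le (ω.endHom B)
      (show C.EndAlg B from C.comp (C.star x) x)
  rw [ω.toFun_star_comp, C.norm_star_comp, Complex.norm_real, Real.norm_of_nonneg (sq_nonneg _)] at h
  exact le_of_sq_le_sq h (norm_nonneg _)

/-- Passes from the inverse-based form of positivity to the real spectrum, on which the continuous
functional calculus operates: if r·1 − a had a two-sided inverse, r would not be in the spectrum. -/
theorem spectrum_nonneg_of_isPositiveIn {A : C.Obj} {a : C.EndAlg A}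
    (ha : IsPositiveIn (C.comp (A := A) (B := A) (C := A)) (C.one A) (C.star (A := A) (B := A)) a)
    {r : ℝ} (hr : r ∈ _root_.spectrum ℝ a) : 0 ≤ r := by
  have h := ha.2 (r : ℂ) ?_
  · simpa using h.1
  · rintro ⟨b, hb, hb'⟩
    rw [← _root_.spectrum.algebraMap_mem_iff ℂ, _root_.spectrum.mem_iff] at hr
    refine hr ?_
    rw [Algebra.algebraMap_eq_smul_one]
    exact ⟨⟨_, b, hb, hb'⟩, rfl⟩

/-- The element `g = 2 (1 + a)⁻¹`, for `a` positive. -/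
theorem exists_cutoff {V : Type*} [CStarAlgebra V] {a : V} (ha : IsSelfAdjoint a)
    (hspec : ∀ r ∈ _root_.spectrum ℝ a, 0 ≤ r) :
    ∃ g : V, Star.star g = g ∧ g * (1 + a) = (2 : ℂ) • 1 ∧ ‖g * a * g‖ ≤ 1 := by
  have hc : ContinuousOn (fun t : ℝ => 2 / (1 + t)) (_root_.spectrum ℝ a) := by
    refine ContinuousOn.div (by fun_prop) (by fun_prop) fun t ht => ?_
    linarith [hspec t ht]
  -- The numerator 2 is the largest that gives norm at most 1 for every a: 4t/(1 + t)² has maximum 1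
  -- on t ≥ 0, attained at t = 1. There 2/(1 + t) is 1, which preserves ω(x) = 1 when a = x^* ∘ x.
  refine ⟨cfc (fun t : ℝ => 2 / (1 + t)) a,
    cfc_predicate (R := ℝ) (fun t : ℝ => 2 / (1 + t)) a, ?_, ?_⟩
  · have h1 : 1 + a = cfc (fun t : ℝ => 1 + t) a := by
      rw [cfc_const_add 1 (fun t : ℝ => t) a, cfc_id' ℝ a, map_one]
    rw [h1, ← cfc_mul _ _ a hc (by fun_prop)]
    have h2 : cfc (fun t : ℝ => 2 / (1 + t) * (1 + t)) a = cfc (fun _ : ℝ => (2 : ℝ)) a := by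
      refine cfc_congr fun t ht => ?_
      have : (1 + t) ≠ 0 := by linarith [hspec t ht]
      field_simp
    rw [h2, cfc_const _ a, Algebra.algebraMap_eq_smul_one]
    norm_num [two_smul]
  · have h2 : cfc (fun t : ℝ => 2 / (1 + t) * t * (2 / (1 + t))) a =
        cfc (fun t : ℝ => 2 / (1 + t)) a * a * cfc (fun t : ℝ => 2 / (1 + t)) a := by
      rw [cfc_mul (fun t : ℝ => 2 / (1 + t) * t) _ a (hc.mul continuousOn_id) hc,
        cfc_mul _ (fun t : ℝ => t) a hc continuousOn_id, cfc_id' ℝ a]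
    rw [← h2]
    refine norm_cfc_le zero_le_one fun t ht => ?_
    have h0 := hspec t ht
    rw [Real.norm_of_nonneg (by positivity)]
    have : 2 / (1 + t) * t * (2 / (1 + t)) = 4 * t / (1 + t) ^ 2 := by
      field_simp; ring
    rw [this, div_le_one (by positivity)]
    nlinarith [sq_nonneg (1 - t)]

/-- A `*`-functor to `ℂ` that is nonzero on `𝒞_{AB}` takes the value one on its unit ball. The
proof cuts off an `x` with `ω x = 1` to `2 x (1 + x^* x)⁻¹`. -/
theorem _root_.Character.exists_norm_le_one (ω : Character C) {A B : C.Obj} {x : C.Hom A B}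
    (hx : ω.toFun x = 1) : ∃ y : C.Hom A B, ω.toFun y = 1 ∧ ‖y‖ ≤ 1 := by
  have hpos := C.star_comp_pos x
  obtain ⟨g, hgs, hg1, hg2⟩ : ∃ g : C.Hom B B, C.star g = g ∧
      C.comp g (C.one B + C.comp (C.star x) x) = (2 : ℂ) • C.one B ∧
      ‖C.comp (C.comp g (C.comp (C.star x) x)) g‖ ≤ 1 :=
    exists_cutoff (V := C.EndAlg B) hpos.1 fun r hr => spectrum_nonneg_of_isPositiveIn hpos hr
  have hωg : ω.toFun g = 1 := by
    -- As ω(x^* ∘ x) = 1, applying ω to g ∘ (1 + x^* ∘ x) = 2 gives 2 ω(g) = 2.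
    have := congrArg ω.toFun hg1
    rw [ω.map_comp, map_add, map_smul, ω.map_one, ω.toFun_star_comp, hx, smul_eq_mul] at this
    norm_num at this
    exact this
  refine ⟨C.comp x g, by rw [ω.map_comp, hx, hωg, one_mul], ?_⟩
  have h := C.norm_star_comp (C.comp x g)
  -- Since g is self-adjoint, the C*-identity turns ‖x ∘ g‖² into ‖g ∘ (x^* ∘ x) ∘ g‖.
  rw [C.star_comp, hgs, C.assoc, ← C.assoc (C.star x) x, ← C.assoc] at h
  exact (sq_le_one_iff₀ (norm_nonneg _)).1 (h ▸ hg2)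

namespace Spec

/-- Modulo ker ω, x equals ω(x) y with ω(y) = 1 and ‖y‖ ≤ 1, which bounds the norm above; below, ω
is contractive and takes the same value on all representatives. Thus ω induces an isometry of the
fibre onto ℂ. -/
theorem norm_gelfand_mk {A B : C.Obj} (ω : Character C) (hω : (ω.toFun (A := A) (B := B)) ≠ 0)
    (x : C.Hom A B) : ‖gelfand x (mk ω hω)‖ = ‖ω.toFun x‖ := by
  apply le_antisymm
  · obtain ⟨y, hy⟩ : ∃ y : C.Hom A B, ω.toFun y = 1 := LinearMap.surjective hω 1
    obtain ⟨y, hy, hy1⟩ := ω.exists_norm_le_one hy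
    have h : gelfand x (mk ω hω) = gelfand (ω.toFun x • y) (mk ω hω) := by
      refine (Submodule.Quotient.eq _).2 ?_
      change ω.toFun (x - ω.toFun x • y) = 0
      rw [map_sub, map_smul, hy, smul_eq_mul, mul_one, sub_self]
    rw [h]
    refine (Submodule.Quotient.norm_mk_le _ _).trans ?_
    rw [norm_smul]
    exact mul_le_of_le_one_right (norm_nonneg _) hy1
  · refine le_of_forall_pos_le_add fun ε hε => ?_
    obtain ⟨m, hm, hm'⟩ := Submodule.Quotient.norm_mk_lt (gelfand x (mk ω hω)) hε
    have h : ω.toFun (m - x) = 0 := (Submodule.Quotient.eq _).1 hm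
    rw [map_sub, sub_eq_zero] at h
    rw [← h]
    exact (ω.norm_le m).trans hm'.le

theorem gelfand_surjective {A B : C.Obj} {p : C.Spec A B} (e : Fib A B p) :
    ∃ x : C.Hom A B, gelfand x p = e := Submodule.Quotient.mk_surjective _ e

theorem gelfand_sub {A B : C.Obj} (p : C.Spec A B) (x y : C.Hom A B) :
    gelfand (x - y) p = gelfand x p - gelfand y p := rfl

theorem gelfand_add {A B : C.Obj} (p : C.Spec A B) (x y : C.Hom A B) :
    gelfand (x + y) p = gelfand x p + gelfand y p := rfl

theorem gelfand_smul {A B : C.Obj} (p : C.Spec A B) (z : ℂ) (x : C.Hom A B) :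
    gelfand (z • x) p = z • gelfand x p := rfl

theorem fibMul_gelfand {A B D : C.Obj} {p : C.Spec A B} {q : C.Spec B D} (h : src p = tgt q)
    (x : C.Hom A B) (y : C.Hom B D) :
    fibMul h (gelfand x p) (gelfand y q) = gelfand (C.comp x y) (comp p q h) := rfl

theorem fibStar_gelfand {A B : C.Obj} (p : C.Spec A B) (x : C.Hom A B) :
    fibStar (gelfand x p) = gelfand (C.star x) (inv p) := rfl

theorem norm_eq_zero_iff {A B : C.Obj} {p : C.Spec A B} (e : Fib A B p) : ‖e‖ = 0 ↔ e = 0 := by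
  refine ⟨fun h => ?_, fun h => by rw [h, norm_zero]⟩
  induction p using ind with
  | h ω hω =>
  obtain ⟨x, rfl⟩ := gelfand_surjective e
  rw [norm_gelfand_mk, norm_eq_zero] at h
  exact (Submodule.Quotient.mk_eq_zero _).2 h

/-- Composable points share a representative ω, and on the three fibres involved the norm is the
modulus of ω. The equality, stronger than submultiplicativity, also yields the C*-identity and the
nonvanishing of products. -/
theorem norm_fibMul {A B D : C.Obj} {p : C.Spec A B} {q : C.Spec B D} (h : src p = tgt q)
    (e : Fib A B p) (f : Fib B D q) : ‖fibMul h e f‖ = ‖e‖ * ‖f‖ := by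
  induction p, q, h using ind₂ with
  | H ω hω hω' h =>
  obtain ⟨x, rfl⟩ := gelfand_surjective e
  obtain ⟨y, rfl⟩ := gelfand_surjective f
  rw [fibMul_gelfand, norm_gelfand_mk, norm_gelfand_mk, ← norm_mul, ← ω.map_comp]
  exact norm_gelfand_mk ω (comp (mk ω hω) (mk ω hω') h |>.2 |> (finrank_quotient_ker ω).1) _

theorem toFun_ne_zero_symm {A B : C.Obj} {ω : Character C} (hω : (ω.toFun (A := A) (B := B)) ≠ 0) :
    (ω.toFun (A := B) (B := A)) ≠ 0 := fun h => hω (LinearMap.ext fun x => by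
  have := congrArg (fun f => f (C.star x)) h
  simpa [ω.map_star] using this)

theorem norm_fibStar {A B : C.Obj} {p : C.Spec A B} (e : Fib A B p) : ‖fibStar e‖ = ‖e‖ := by
  induction p using ind with
  | h ω hω =>
  obtain ⟨x, rfl⟩ := gelfand_surjective e
  rw [fibStar_gelfand, norm_gelfand_mk, ← Complex.norm_conj (ω.toFun x), ← ω.map_star]
  exact norm_gelfand_mk ω (toFun_ne_zero_symm hω) _

end Spec
end CStarCat

/-! ### The space of characters and the base groupoid -/

namespace CStarCat

section CharacterSpace

variable {C D : CStarCat.{u, v}}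

theorem _root_.Character.isInducing_toFun :
    IsInducing (fun (ω : Character C) (x : Σ A B, C.Hom A B) => ω.toFun x.2.2) := ⟨rfl⟩

theorem _root_.Character.continuous_toFun {A B : C.Obj} (x : C.Hom A B) :
    Continuous fun ω : Character C => ω.toFun x :=
  (continuous_apply (⟨A, B, x⟩ : Σ A B, C.Hom A B)).comp Character.isInducing_toFun.continuous

theorem _root_.Character.continuous_pullback (φ : StarFunctor C D) :
    Continuous fun ω : Character D => ω.pullback φ :=
  Character.isInducing_toFun.continuous_iff.2
    (continuous_pi fun x => Character.continuous_toFun (φ.map x.2.2))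

/-- The axioms of a linear `*`-functor are equations between continuous functions of finitely many
values of ω. -/
theorem _root_.Character.isClosed_range_toFun :
    IsClosed (Set.range
      (fun (ω : Character C) (x : Σ A B, C.Hom A B) => ω.toFun x.2.2)) := by
  have h : Set.range (fun (ω : Character C) (x : Σ A B, C.Hom A B) => ω.toFun x.2.2) =
      {f | (∀ A B (x y : C.Hom A B), f ⟨A, B, x + y⟩ = f ⟨A, B, x⟩ + f ⟨A, B, y⟩) ∧
        (∀ A B (z : ℂ) (x : C.Hom A B), f ⟨A, B, z • x⟩ = z * f ⟨A, B, x⟩) ∧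
        (∀ A, f ⟨A, A, C.one A⟩ = 1) ∧
        (∀ A B E (x : C.Hom A B) (y : C.Hom B E),
          f ⟨A, E, C.comp x y⟩ = f ⟨A, B, x⟩ * f ⟨B, E, y⟩) ∧
        ∀ A B (x : C.Hom A B), f ⟨B, A, C.star x⟩ = starRingEnd ℂ (f ⟨A, B, x⟩)} := by
    ext f
    constructor
    · rintro ⟨ω, rfl⟩
      exact ⟨fun A B x y => map_add _ x y, fun A B z x => map_smul _ z x, ω.map_one,
        fun A B E x y => ω.map_comp x y, fun A B x => ω.map_star x⟩
    · rintro ⟨h1, h2, h3, h4, h5⟩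
      exact ⟨{ toFun := fun {A B} =>
                { toFun := fun x => f ⟨A, B, x⟩
                  map_add' := h1 A B
                  map_smul' := h2 A B }
               map_one := h3
               map_comp := fun x y => h4 _ _ _ x y
               map_star := fun x => h5 _ _ x }, rfl⟩
  rw [h]
  simp only [Set.ofPred_and, Set.ofPred_forall]
  refine .inter ?_ (.inter ?_ (.inter ?_ (.inter ?_ ?_)))
  all_goals
    repeat' refine isClosed_iInter fun _ => ?_
    refine isClosed_eq ?_ ?_ <;> fun_prop

/-- The Banach–Alaoglu argument: contractivity places the characters in a product of closed discs,
as a closed subset. -/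
instance : CompactSpace (Character C) := by
  refine ⟨Character.isInducing_toFun.isCompact_iff.2 ?_⟩
  rw [Set.image_univ]
  refine (isCompact_univ_pi fun x : Σ A B, C.Hom A B =>
    isCompact_closedBall (0 : ℂ) ‖x.2.2‖).of_isClosed_subset Character.isClosed_range_toFun ?_
  rintro _ ⟨ω, rfl⟩ x -
  exact mem_closedBall_zero_iff.2 (ω.norm_le x.2.2)

theorem _root_.Character.isOpen_setOf_toFun_ne_zero (A B : C.Obj) :
    IsOpen {ω : Character C | (ω.toFun (A := A) (B := B)) ≠ 0} := by
  have : {ω : Character C | (ω.toFun (A := A) (B := B)) ≠ 0} =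
      ⋃ x : C.Hom A B, {ω : Character C | ω.toFun x ≠ 0} := by
    ext ω
    simp only [Set.mem_ofPred_eq, Set.mem_iUnion, ne_eq, LinearMap.ext_iff, LinearMap.zero_apply,
      not_forall]
  rw [this]
  exact isOpen_iUnion fun x => isOpen_ne_fun (Character.continuous_toFun x) continuous_const

theorem isOpen_setOf_finrank_eq_one (A B : C.Obj) :
    IsOpen {b : C.Orbit A B | Module.finrank ℂ (C.Hom A B ⧸ b.ker) = 1} := by
  have hq : IsQuotientMap (Orbit.mk A B : Character C → C.Orbit A B) := isQuotientMap_quot_mk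
  rw [← hq.isOpen_preimage]
  convert Character.isOpen_setOf_toFun_ne_zero A B using 1
  ext ω
  exact finrank_quotient_ker ω

end CharacterSpace

namespace Spec

variable {C D : CStarCat.{u, v}} {A B : C.Obj}

theorem continuous_mk : Continuous
    fun ω : {ω : Character C // (ω.toFun (A := A) (B := B)) ≠ 0} => mk ω.1 ω.2 :=
  Continuous.subtype_mk (continuous_quotient_mk'.comp continuous_subtype_val) _

/-- A quotient map restricts to a quotient map over an open subset, and X_{AB} is open in the space
of orbits. Continuity on X_{AB} can therefore be tested on characters. -/
theorem isQuotientMap_mk : IsQuotientMap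
    fun ω : {ω : Character C // (ω.toFun (A := A) (B := B)) ≠ 0} => mk ω.1 ω.2 := by
  have hq : IsQuotientMap (Orbit.mk A B : Character C → C.Orbit A B) := isQuotientMap_quot_mk
  have h := hq.restrictPreimage_isOpen (isOpen_setOf_finrank_eq_one A B)
  exact IsQuotientMap.of_comp
    (f := fun ω : Orbit.mk A B ⁻¹' {b : C.Orbit A B | Module.finrank ℂ (C.Hom A B ⧸ b.ker) = 1} =>
      (⟨ω.1, (finrank_quotient_ker ω.1).1 ω.2⟩ :
        {ω : Character C // (ω.toFun (A := A) (B := B)) ≠ 0}))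
    (continuous_subtype_val.subtype_mk _) continuous_mk h

theorem continuous_of_mk {β : Type*} [TopologicalSpace β] {f : C.Spec A B → β}
    (h : Continuous fun ω : {ω : Character C // (ω.toFun (A := A) (B := B)) ≠ 0} =>
      f (mk ω.1 ω.2)) : Continuous f :=
  isQuotientMap_mk.continuous_iff.2 h

theorem continuous_mk_self : Continuous
    fun ω : Character C => (mk ω (toFun_ne_zero_self ω A) : C.Spec A A) :=
  Continuous.subtype_mk continuous_quotient_mk' _

/-- A character is nonzero on every 𝒞_{AA}, because it is unital; so X_{AA} is a quotient of the
whole compact space of characters. -/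
theorem isQuotientMap_mk_self : IsQuotientMap
    fun ω : Character C => (mk ω (toFun_ne_zero_self ω A) : C.Spec A A) :=
  IsQuotientMap.of_comp (f := Subtype.val) continuous_subtype_val continuous_mk_self
    (isQuotientMap_mk (A := A) (B := A))

theorem mk_eq_mk_iff {ω ρ : Character C} (hω : (ω.toFun (A := A) (B := B)) ≠ 0)
    (hρ : (ρ.toFun (A := A) (B := B)) ≠ 0) : mk ω hω = mk ρ hρ ↔ (C.gauge A B).r ω ρ :=
  ⟨fun h => Quotient.exact (congrArg Subtype.val h), fun h => Subtype.ext (Quotient.sound h)⟩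

theorem mk_eq_mk_of_self {ω ρ : Character C} (hω : (ω.toFun (A := A) (B := B)) ≠ 0)
    (hρ : (ρ.toFun (A := A) (B := B)) ≠ 0)
    (h : (mk ω (toFun_ne_zero_self ω A) : C.Spec A A) = mk ρ (toFun_ne_zero_self ρ A)) :
    mk ω hω = mk ρ hρ :=
  (mk_eq_mk_iff _ _).2
    (gauge_of_eq (eq_of_gauge (toFun_ne_zero_self ω A) ((mk_eq_mk_iff _ _).1 h)) B)

/-- A point with target `[ω]_{AA}` is `[ω]_{AB}`. -/
theorem eq_mk_of_tgt_eq {q : C.Spec A B} {ω : Character C}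
    (h : tgt q = mk ω (toFun_ne_zero_self ω A)) :
    ∃ hω : (ω.toFun (A := A) (B := B)) ≠ 0, q = mk ω hω := by
  induction q using ind with
  | h ρ hρ =>
  obtain ⟨u, hu⟩ := gauge_of_eq
    (eq_of_gauge (toFun_ne_zero_self ρ A)
    ((mk_eq_mk_iff (toFun_ne_zero_self ρ A) _).1 h)) B
  have hω : (ω.toFun (A := A) (B := B)) ≠ 0 := fun h0 => hρ (LinearMap.ext fun x => by
    have h1 := hu x
    rw [h0, LinearMap.zero_apply, eq_comm, mul_eq_zero] at h1
    exact h1.resolve_left (Circle.coe_ne_zero u))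
  exact ⟨hω, mk_eq_mk_of_self _ _ h⟩

theorem tgt_self (p : C.Spec A A) : tgt p = p := by
  induction p using ind with
  | h ω hω => rfl

theorem src_self (p : C.Spec A A) : src p = p := by
  induction p using ind with
  | h ω hω => rfl

theorem tgt_inv (p : C.Spec A B) : tgt (inv p) = src p := by
  induction p using ind with
  | h ω hω => rfl

theorem src_inv (p : C.Spec A B) : src (inv p) = tgt p := by
  induction p using ind with
  | h ω hω => rfl

theorem inv_inv (p : C.Spec A B) : inv (inv p) = p := by
  induction p using ind with
  | h ω hω => rfl

/-- The values of ω on 𝒞_{AA} fix its restriction to 𝒞_{AB} up to a phase. -/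
theorem tgt_injective : Function.Injective (tgt : C.Spec A B → C.Spec A A) := by
  intro p q h
  induction p using ind with
  | h ω hω =>
  obtain ⟨_, rfl⟩ := eq_mk_of_tgt_eq h.symm
  rfl

theorem continuous_tgt : Continuous (tgt : C.Spec A B → C.Spec A A) :=
  continuous_of_mk (continuous_mk_self.comp continuous_subtype_val)

/-- Pulled back to characters, the image of W becomes the set of those ω that are nonzero on 𝒞_{AB}
and have [ω]_{AB} in W: an open subset of an open set. -/
theorem isOpenMap_tgt : IsOpenMap (tgt : C.Spec A B → C.Spec A A) := by
  intro W hW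
  rw [← isQuotientMap_mk_self.isOpen_preimage]
  have h := (Character.isOpen_setOf_toFun_ne_zero A B).isOpenMap_subtype_val _
    (hW.preimage continuous_mk)
  convert h using 1
  ext ω
  constructor
  · rintro ⟨p, hp, h⟩
    obtain ⟨hω, rfl⟩ := eq_mk_of_tgt_eq h
    exact ⟨⟨ω, hω⟩, hp, rfl⟩
  · rintro ⟨⟨ω, hω⟩, hp, rfl⟩
    exact ⟨mk ω hω, hp, rfl⟩

theorem isOpenEmbedding_tgt : IsOpenEmbedding (tgt : C.Spec A B → C.Spec A A) :=
  .of_continuous_injective_isOpenMap continuous_tgt tgt_injective isOpenMap_tgt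

theorem continuous_inv : Continuous (inv : C.Spec A B → C.Spec B A) :=
  continuous_of_mk (continuous_mk.comp
    (continuous_subtype_val.subtype_mk fun ω => toFun_ne_zero_symm ω.2))

theorem isOpenEmbedding_src : IsOpenEmbedding (src : C.Spec A B → C.Spec B B) := by
  have : (src : C.Spec A B → C.Spec B B) = tgt ∘ (⟨⟨inv, inv, inv_inv, inv_inv⟩, continuous_inv,
      continuous_inv⟩ : C.Spec A B ≃ₜ C.Spec B A) := funext fun p => (tgt_inv p).symm
  rw [this]
  exact isOpenEmbedding_tgt.comp (Homeomorph.isOpenEmbedding _)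

instance : CompactSpace (C.Spec A A) := by
  refine ⟨?_⟩
  rw [← isQuotientMap_mk_self.surjective.range_eq]
  exact isCompact_range continuous_mk_self

/-- The Gel'fand transform of an element of `𝒞_{AA}`, as a function on `X_{AA}`. -/
def eval (a : C.Hom A A) : C.Spec A A → ℂ :=
  lift (fun ω _ => ω.toFun a) fun _ _ hω _ h => eq_of_gauge hω h a

theorem continuous_eval (a : C.Hom A A) : Continuous (eval a) :=
  continuous_of_mk ((Character.continuous_toFun a).comp continuous_subtype_val)

/-- On the diagonal the phase is trivial, because ω(ι_A) = 1. Evaluations at elements of 𝒞_{AA} are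
thus well defined and continuous, and they separate points. -/
instance : T2Space (C.Spec A A) := by
  refine T2Space.of_injective_continuous (f := fun p (a : C.Hom A A) => eval a p) ?_
    (continuous_pi fun a => continuous_eval a)
  intro p q h
  induction p using ind with
  | h ω hω =>
  induction q using ind with
  | h ρ hρ =>
  exact (mk_eq_mk_iff _ _).2 (gauge_of_eq (fun a => congrFun h a) A)

/-- The modulus |ω(x)| does not see the phase and is continuous in ω. All continuity statements
about the bundle rest on this. -/
theorem continuous_norm_gelfand (x : C.Hom A B) :
    Continuous fun p : C.Spec A B => ‖gelfand x p‖ := by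
  refine continuous_of_mk ?_
  simp only [norm_gelfand_mk]
  exact ((Character.continuous_toFun x).comp continuous_subtype_val).norm

theorem tgt_comp {E : C.Obj} (p : C.Spec A B) (q : C.Spec B E) (h : src p = tgt q) :
    tgt (comp p q h) = tgt p := by
  induction p, q, h using ind₂ with
  | H ω hω hω' h => rfl

theorem src_comp {E : C.Obj} (p : C.Spec A B) (q : C.Spec B E) (h : src p = tgt q) :
    src (comp p q h) = src q := by
  induction p, q, h using ind₂ with
  | H ω hω hω' h => rfl

theorem continuous_comp (A B E : C.Obj) : Continuous
    (fun pq : {pq : C.Spec A B × C.Spec B E // src pq.1 = tgt pq.2} => comp pq.1.1 pq.1.2 pq.2) := by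
  -- The target map induces the topology, and the target of p ∘ q is that of p.
  rw [isOpenEmbedding_tgt.isInducing.continuous_iff]
  simp only [Function.comp_def, tgt_comp]
  exact continuous_tgt.comp (continuous_fst.comp continuous_subtype_val)

theorem continuous_specMap (φ : StarFunctor C D) (hφ : φ.IsNondegenerate) :
    Continuous (specMap φ hφ (A := A) (B := B)) :=
  continuous_of_mk (continuous_mk.comp
    (((Character.continuous_pullback φ).comp continuous_subtype_val).subtype_mk
      fun ω => hφ ω.1 A B ω.2))

theorem specMap_tgt (φ : StarFunctor C D) (hφ : φ.IsNondegenerate)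
    (p : D.Spec (φ.obj A) (φ.obj B)) : specMap φ hφ (tgt p) = tgt (specMap φ hφ p) := by
  induction p using ind with
  | h ω hω => rfl

/-- The claim is transferred by target maps to the diagonal, where the spaces are compact Hausdorff.
-/
theorem isCompact_preimage_specMap (φ : StarFunctor C D) (hφ : φ.IsNondegenerate)
    {K : Set (C.Spec A B)} (hK : IsCompact K) : IsCompact (specMap φ hφ ⁻¹' K) := by
  have h : specMap φ hφ ⁻¹' K = tgt ⁻¹' (specMap φ hφ (A := A) (B := A) ⁻¹' (tgt '' K)) := by
    ext p
    simp only [Set.mem_preimage, specMap_tgt]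
    exact (tgt_injective.mem_set_image).symm
  rw [h]
  -- The preimage of the compact, hence closed, set `tgt '' K` is closed in a compact space. It
  -- remains to see that it lies in the range of the target map: ω ∘ φ nonzero on 𝒞_{AB} forces ω
  -- nonzero on 𝒟_{φ(A)φ(B)}.
  refine isOpenEmbedding_tgt.isInducing.isCompact_preimage'
    ((hK.image continuous_tgt).isClosed.preimage (continuous_specMap φ hφ)).isCompact ?_
  rintro q ⟨r, -, hr⟩
  induction q using ind with
  | h ω hω =>
  obtain ⟨h0, -⟩ := eq_mk_of_tgt_eq (ω := ω.pullback φ) hr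
  exact ⟨mk ω (fun h1 => h0 (LinearMap.ext fun x => congrArg (fun f => f (φ.map x)) h1)), rfl⟩

end Spec

theorem isBase_spectrum (C : CStarCat.{u, v}) : C.spectrum.IsBase where
  src_self := Spec.src_self
  tgt_self := Spec.tgt_self
  src_comp := Spec.src_comp
  tgt_comp := Spec.tgt_comp
  assoc p q r h₁ h₂ h₃ h₄ := Spec.tgt_injective <|
    (Spec.tgt_comp _ _ h₃).trans <| (Spec.tgt_comp _ _ h₁).trans (Spec.tgt_comp _ _ h₄).symm
  tgt_comp_self p h := Spec.tgt_injective <| (Spec.tgt_comp _ _ h).trans (Spec.tgt_self _)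
  comp_src_self p h := Spec.tgt_injective <| Spec.tgt_comp _ _ h
  src_inv := Spec.src_inv
  tgt_inv := Spec.tgt_inv
  comp_inv p h := Spec.tgt_injective <| (Spec.tgt_comp _ _ h).trans (Spec.tgt_self _).symm
  inv_comp p h := Spec.tgt_injective <| (Spec.tgt_comp _ _ h).trans <|
    (Spec.tgt_inv p).trans (Spec.tgt_self _).symm
  continuous_comp := Spec.continuous_comp
  continuous_inv _ _ := Spec.continuous_inv
  compactSpace (A : C.Obj) := inferInstanceAs (CompactSpace (C.Spec A A))
  t2Space (A : C.Obj) := inferInstanceAs (T2Space (C.Spec A A))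
  isOpenEmbedding_src _ _ := Spec.isOpenEmbedding_src
  isOpenEmbedding_tgt _ _ := Spec.isOpenEmbedding_tgt

end CStarCat

/-! ### The tubular topology and the Fell bundle -/

namespace CStarCat

namespace Spec

variable {C D : CStarCat.{u, v}} {A B : C.Obj}

theorem isOpen_tube (x : C.Hom A B) {ε : ℝ} (hε : 0 < ε) {O : Set (C.Spec A B)} (hO : IsOpen O) :
    IsOpen (tube x ε O) :=
  TopologicalSpace.isOpen_generateFrom_of_mem ⟨x, ε, O, hε, hO, rfl⟩

theorem continuous_proj :
    Continuous (TotalSpace.proj : TotalSpace ℂ (Fib A B) → C.Spec A B) := by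
  refine ⟨fun O hO => ?_⟩
  have h : TotalSpace.proj ⁻¹' O = ⋃ x : C.Hom A B, tube x 1 O := by
    ext e
    simp only [Set.mem_preimage, Set.mem_iUnion]
    constructor
    · intro he
      obtain ⟨x, hx⟩ := gelfand_surjective e.snd
      exact ⟨x, he, by rw [hx, sub_self, norm_zero]; exact one_pos⟩
    · rintro ⟨x, hx⟩
      exact hx.1
  rw [h]
  exact isOpen_iUnion fun x => isOpen_tube x one_pos hO

/-- The tubes around the Gel'fand transform of `x` form a neighbourhood base of its points. -/
theorem nhds_gelfand (x : C.Hom A B) (p : C.Spec A B) :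
    𝓝 (⟨p, gelfand x p⟩ : TotalSpace ℂ (Fib A B)) = Filter.comap TotalSpace.proj (𝓝 p) ⊓
      Filter.comap (fun e : TotalSpace ℂ (Fib A B) => ‖e.snd - gelfand x e.proj‖) (𝓝 0) := by
  apply le_antisymm
  · refine le_inf ?_ ?_
    · exact (continuous_proj.tendsto (⟨p, gelfand x p⟩ : TotalSpace ℂ (Fib A B))).le_comap
    · rw [← Filter.tendsto_iff_comap, Metric.tendsto_nhds]
      intro ε hε
      refine Filter.mem_of_superset ((isOpen_tube x hε isOpen_univ).mem_nhds
        ⟨trivial, by simpa using hε⟩) fun e he => ?_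
      simpa using he.2
  · rw [TopologicalSpace.nhds_generateFrom]
    refine le_iInf₂ fun U ⟨hU, y, ε, O, hε, hO, hUe⟩ => ?_
    subst hUe
    rw [Filter.le_principal_iff]
    -- Near p the transforms of x and y stay within r of each other, which leaves room ε − r for a
    -- tube around x.
    obtain ⟨r, hr, hrε⟩ := exists_between hU.2
    have h1 : {q : C.Spec A B | q ∈ O ∧ ‖gelfand (x - y) q‖ < r} ∈ 𝓝 p :=
      Filter.inter_mem (hO.mem_nhds hU.1)
        ((isOpen_lt (continuous_norm_gelfand (x - y)) continuous_const).mem_nhds hr)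
    refine Filter.mem_of_superset (Filter.inter_mem_inf (Filter.preimage_mem_comap h1)
      (Filter.preimage_mem_comap (Iio_mem_nhds (sub_pos.2 hrε)))) ?_
    rintro e ⟨⟨he1, he2⟩, he3⟩
    refine ⟨he1, ?_⟩
    have h2 : e.snd - gelfand y e.proj =
        (e.snd - gelfand x e.proj) + gelfand (x - y) e.proj := by
      rw [gelfand_sub]; abel
    rw [h2]
    have h3 : ‖e.snd - gelfand x e.proj‖ < ε - r := he3
    linarith [norm_add_le (e.snd - gelfand x e.proj) (gelfand (x - y) e.proj)]

theorem tendsto_nhds_gelfand {ι : Type*} {l : Filter ι} {f : ι → TotalSpace ℂ (Fib A B)}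
    {x : C.Hom A B} {p : C.Spec A B} :
    Filter.Tendsto f l (𝓝 ⟨p, gelfand x p⟩) ↔ Filter.Tendsto (fun i => (f i).proj) l (𝓝 p) ∧
      Filter.Tendsto (fun i => ‖(f i).snd - gelfand x (f i).proj‖) l (𝓝 0) := by
  rw [nhds_gelfand, Filter.tendsto_inf, Filter.tendsto_comap_iff, Filter.tendsto_comap_iff]
  rfl

theorem tendsto_nhds_gelfand_of_le {ι : Type*} {l : Filter ι} {f : ι → TotalSpace ℂ (Fib A B)}
    {x : C.Hom A B} {p : C.Spec A B} {g : ι → ℝ}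
    (h : Filter.Tendsto (fun i => (f i).proj) l (𝓝 p))
    (hf : ∀ i, ‖(f i).snd - gelfand x (f i).proj‖ ≤ g i) (hg : Filter.Tendsto g l (𝓝 0)) :
    Filter.Tendsto f l (𝓝 ⟨p, gelfand x p⟩) :=
  tendsto_nhds_gelfand.2 ⟨h, squeeze_zero (fun _ => norm_nonneg _) hf hg⟩

theorem tendsto_norm_sub_gelfand (x : C.Hom A B) (p : C.Spec A B) :
    Filter.Tendsto (fun e : TotalSpace ℂ (Fib A B) => ‖e.snd - gelfand x e.proj‖)
      (𝓝 ⟨p, gelfand x p⟩) (𝓝 0) :=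
  (tendsto_nhds_gelfand.1 Filter.tendsto_id).2

theorem continuous_gelfand (x : C.Hom A B) :
    Continuous fun p => (⟨p, gelfand x p⟩ : TotalSpace ℂ (Fib A B)) :=
  continuous_iff_continuousAt.2 fun p => tendsto_nhds_gelfand.2
    ⟨Filter.tendsto_id, by simp only [sub_self, norm_zero]; exact tendsto_const_nhds⟩

theorem continuous_norm : Continuous fun e : TotalSpace ℂ (Fib A B) => ‖e.snd‖ := by
  refine continuous_iff_continuousAt.2 fun ⟨p, e⟩ => ?_
  obtain ⟨x, rfl⟩ := gelfand_surjective e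
  have h1 : Filter.Tendsto (fun e : TotalSpace ℂ (Fib A B) => ‖e.snd‖ - ‖gelfand x e.proj‖)
      (𝓝 ⟨p, gelfand x p⟩) (𝓝 0) :=
    squeeze_zero_norm (fun e => abs_norm_sub_norm_le _ _) (tendsto_norm_sub_gelfand x p)
  have h2 := ((continuous_norm_gelfand x).comp continuous_proj).tendsto
    (⟨p, gelfand x p⟩ : TotalSpace ℂ (Fib A B))
  simpa [ContinuousAt] using h1.add h2

theorem continuous_add : Continuous (fun e : TotalSpace (ℂ × ℂ) (Fib A B ×ᵇ Fib A B) =>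
    (⟨e.proj, e.snd.1 + e.snd.2⟩ : TotalSpace ℂ (Fib A B))) := by
  refine continuous_iff_continuousAt.2 fun ⟨p, e, f⟩ => ?_
  obtain ⟨x, rfl⟩ := gelfand_surjective e
  obtain ⟨y, rfl⟩ := gelfand_surjective f
  have hd := (FiberBundle.Prod.isInducing_diag ℂ (Fib A B) ℂ (Fib A B)).continuous
  have h1 := tendsto_nhds_gelfand.1 ((continuous_fst.comp hd).tendsto
    (⟨p, gelfand x p, gelfand y p⟩ : TotalSpace (ℂ × ℂ) (Fib A B ×ᵇ Fib A B)))
  have h2 := tendsto_nhds_gelfand.1 ((continuous_snd.comp hd).tendsto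
    (⟨p, gelfand x p, gelfand y p⟩ : TotalSpace (ℂ × ℂ) (Fib A B ×ᵇ Fib A B)))
  refine tendsto_nhds_gelfand (x := x + y).2 ⟨h1.1, ?_⟩
  refine squeeze_zero (fun _ => norm_nonneg _) (fun e => ?_) (by simpa using h1.2.add h2.2)
  refine le_trans (le_of_eq ?_) (norm_add_le _ _)
  congr 1
  change e.snd.1 + e.snd.2 - gelfand (x + y) e.proj =
    (e.snd.1 - gelfand x e.proj) + (e.snd.2 - gelfand y e.proj)
  rw [gelfand_add]; abel

theorem continuous_smul : Continuous (fun e : ℂ × TotalSpace ℂ (Fib A B) =>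
    (⟨e.2.proj, e.1 • e.2.snd⟩ : TotalSpace ℂ (Fib A B))) := by
  refine continuous_iff_continuousAt.2 fun ⟨z, p, e⟩ => ?_
  obtain ⟨x, rfl⟩ := gelfand_surjective e
  have h1 : Filter.Tendsto (fun e : ℂ × TotalSpace ℂ (Fib A B) => ‖e.2.snd - gelfand x e.2.proj‖)
      (𝓝 (z, ⟨p, gelfand x p⟩)) (𝓝 0) := (tendsto_norm_sub_gelfand x p).comp continuousAt_snd
  have h2 : Filter.Tendsto (fun e : ℂ × TotalSpace ℂ (Fib A B) => ‖e.1‖)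
      (𝓝 (z, ⟨p, gelfand x p⟩)) (𝓝 ‖z‖) := continuousAt_fst.norm
  have h3 : Filter.Tendsto (fun e : ℂ × TotalSpace ℂ (Fib A B) => ‖gelfand x e.2.proj‖)
      (𝓝 (z, ⟨p, gelfand x p⟩)) (𝓝 ‖gelfand x p‖) :=
    ((continuous_norm_gelfand x).comp (continuous_proj.comp continuous_snd)).continuousAt
  have h4 : Filter.Tendsto (fun e : ℂ × TotalSpace ℂ (Fib A B) => ‖e.1 - z‖)
      (𝓝 (z, ⟨p, gelfand x p⟩)) (𝓝 0) :=
    tendsto_iff_norm_sub_tendsto_zero.1 continuousAt_fst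
  -- The bound is ‖w e − z x̂‖ ≤ |w| ‖e − x̂‖ + |w − z| ‖x̂‖, where x̂ is the transform of x.
  have h5 := (h2.mul h1).add (h4.mul h3)
  rw [mul_zero, zero_mul, add_zero] at h5
  refine tendsto_nhds_gelfand_of_le (x := z • x)
    (continuous_proj.comp continuous_snd).continuousAt (fun e => ?_) h5
  rw [← norm_smul, ← norm_smul]
  refine le_trans (le_of_eq (congrArg norm ?_)) (norm_add_le _ _)
  rw [gelfand_smul, smul_sub, sub_smul]; abel

theorem isInducing_fibre (p : C.Spec A B) :
    IsInducing (fun e : Fib A B p => (⟨p, e⟩ : TotalSpace ℂ (Fib A B))) := by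
  refine isInducing_iff_nhds.2 fun e => ?_
  obtain ⟨x, rfl⟩ := gelfand_surjective e
  rw [nhds_gelfand, Filter.comap_inf, Filter.comap_comap, Filter.comap_comap,
    ← nhds_comap_dist]
  have h : Filter.comap (TotalSpace.proj ∘ fun e : Fib A B p => (⟨p, e⟩ : TotalSpace ℂ (Fib A B)))
      (𝓝 p) = ⊤ := Filter.comap_const_of_mem fun t ht => mem_of_mem_nhds ht
  -- Along one fibre the base point is constant, so only the distance to the transform matters.
  rw [h, top_inf_eq]
  congr 1
  ext e
  exact dist_eq_norm _ _

theorem exists_tube_zero_subset (p : C.Spec A B) {U : Set (TotalSpace ℂ (Fib A B))}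
    (hU : U ∈ 𝓝 (⟨p, 0⟩ : TotalSpace ℂ (Fib A B))) :
    ∃ ε > 0, ∃ O : Set (C.Spec A B), IsOpen O ∧ p ∈ O ∧
      {e : TotalSpace ℂ (Fib A B) | e.proj ∈ O ∧ ‖e.snd‖ < ε} ⊆ U := by
  have hU' : U ∈ 𝓝 (⟨p, gelfand 0 p⟩ : TotalSpace ℂ (Fib A B)) := hU
  rw [nhds_gelfand] at hU'
  obtain ⟨⟨O, ε⟩, ⟨⟨hp, hO⟩, hε⟩, h⟩ := (((nhds_basis_opens p).comap TotalSpace.proj).inf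
    (Metric.nhds_basis_ball.comap _)).mem_iff.1 hU'
  refine ⟨ε, hε, O, hO, hp, fun e he => h ⟨he.1, ?_⟩⟩
  have h0 : e.snd - gelfand 0 e.proj = e.snd := sub_zero _
  simpa [h0] using he.2

theorem isBanachBundle (A B : C.Obj) : IsBanachBundle (Fib A B : C.Spec A B → Type v) where
  continuous_proj := continuous_proj
  surjective_proj p := ⟨⟨p, 0⟩, rfl⟩
  -- A continuous section passes through every point: a Gel'fand transform.
  isOpenMap_proj := .of_sections fun ⟨p, e⟩ => by
    obtain ⟨x, rfl⟩ := gelfand_surjective e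
    exact ⟨_, (continuous_gelfand x).continuousAt, rfl, fun _ => rfl⟩
  eq_zero_of_norm p e := (norm_eq_zero_iff e).1
  complete p := inferInstance
  continuous_add := continuous_add
  continuous_smul := continuous_smul
  continuous_zero := continuous_gelfand 0
  continuous_norm := continuous_norm
  isInducing_fibre := isInducing_fibre
  tubular p U hU := exists_tube_zero_subset p hU

theorem fibMul_sub {E : C.Obj} {p : C.Spec A B} {q : C.Spec B E} (h : src p = tgt q)
    (e e' : Fib A B p) (f f' : Fib B E q) :
    fibMul h e f - fibMul h e' f' = fibMul h (e - e') f + fibMul h e' (f - f') := by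
  obtain ⟨x, rfl⟩ := gelfand_surjective e
  obtain ⟨x', rfl⟩ := gelfand_surjective e'
  obtain ⟨y, rfl⟩ := gelfand_surjective f
  obtain ⟨y', rfl⟩ := gelfand_surjective f'
  rw [← gelfand_sub, ← gelfand_sub]
  simp only [fibMul_gelfand]
  rw [← gelfand_sub, ← gelfand_add]
  have h1 := C.add_comp (x - x') x' y
  have h2 := C.comp_add x' (y - y') y'
  rw [sub_add_cancel] at h1 h2
  rw [h1, h2]
  congr 1; abel

theorem fibStar_add {p : C.Spec A B} (e f : Fib A B p) :
    fibStar (e + f) = fibStar e + fibStar f := by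
  obtain ⟨x, rfl⟩ := gelfand_surjective e
  obtain ⟨y, rfl⟩ := gelfand_surjective f
  rw [← gelfand_add]
  simp only [fibStar_gelfand]
  rw [C.star_add, gelfand_add]

theorem fibStar_smul {p : C.Spec A B} (z : ℂ) (e : Fib A B p) :
    fibStar (z • e) = (starRingEnd ℂ z) • fibStar e := by
  obtain ⟨x, rfl⟩ := gelfand_surjective e
  rw [← gelfand_smul]
  simp only [fibStar_gelfand]
  rw [C.star_smul, gelfand_smul]

theorem fibStar_sub {p : C.Spec A B} (e f : Fib A B p) :
    fibStar (e - f) = fibStar e - fibStar f := by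
  rw [eq_sub_iff_add_eq, ← fibStar_add, sub_add_cancel]

theorem continuous_fibMul (A B E : C.Obj) : Continuous
    (fun ef : {ef : TotalSpace ℂ (Fib A B) × TotalSpace ℂ (Fib B E) //
      src ef.1.proj = tgt ef.2.proj} =>
      (⟨_, fibMul ef.2 ef.1.1.snd ef.1.2.snd⟩ : TotalSpace ℂ (Fib A E))) := by
  set S := {ef : TotalSpace ℂ (Fib A B) × TotalSpace ℂ (Fib B E) // src ef.1.proj = tgt ef.2.proj}
  have c1 : Continuous fun ef : S => ef.1.1 := continuous_fst.comp continuous_subtype_val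
  have c2 : Continuous fun ef : S => ef.1.2 := continuous_snd.comp continuous_subtype_val
  have c3 : Continuous fun ef : S => comp ef.1.1.proj ef.1.2.proj ef.2 := by
    have h : Continuous fun ef : S => (⟨(ef.1.1.proj, ef.1.2.proj), ef.2⟩ :
        {pq : C.Spec A B × C.Spec B E // src pq.1 = tgt pq.2}) :=
      ((continuous_proj.comp c1).prodMk (continuous_proj.comp c2)).subtype_mk _
    exact (continuous_comp A B E).comp h
  refine continuous_iff_continuousAt.2 fun s => ?_
  obtain ⟨x, hx⟩ := gelfand_surjective s.1.1.snd
  obtain ⟨y, hy⟩ := gelfand_surjective s.1.2.snd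
  have h1 : Filter.Tendsto (fun ef : S => ‖ef.1.1.snd - gelfand x ef.1.1.proj‖) (𝓝 s) (𝓝 0) := by
    have h := c1.tendsto s
    rw [show s.1.1 = ⟨s.1.1.proj, gelfand x s.1.1.proj⟩ by rw [hx]] at h
    exact (tendsto_nhds_gelfand.1 h).2
  have h2 : Filter.Tendsto (fun ef : S => ‖ef.1.2.snd - gelfand y ef.1.2.proj‖) (𝓝 s) (𝓝 0) := by
    have h := c2.tendsto s
    rw [show s.1.2 = ⟨s.1.2.proj, gelfand y s.1.2.proj⟩ by rw [hy]] at h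
    exact (tendsto_nhds_gelfand.1 h).2
  have h3 : Filter.Tendsto (fun ef : S => ‖ef.1.2.snd‖) (𝓝 s) (𝓝 ‖s.1.2.snd‖) :=
    (continuous_norm.comp c2).continuousAt
  have h4 : Filter.Tendsto (fun ef : S => ‖gelfand x ef.1.1.proj‖) (𝓝 s)
      (𝓝 ‖gelfand x s.1.1.proj‖) :=
    ((continuous_norm_gelfand x).comp (continuous_proj.comp c1)).continuousAt
  -- The bound is ‖e f − x̂ ŷ‖ ≤ ‖e − x̂‖ ‖f‖ + ‖x̂‖ ‖f − ŷ‖, with x̂ and ŷ the transforms of x and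
  -- y.
  have h5 := (h1.mul h3).add (h4.mul h2)
  rw [mul_zero, zero_mul, add_zero] at h5
  have h6 : fibMul s.2 s.1.1.snd s.1.2.snd = gelfand (C.comp x y) _ := by
    rw [← hx, ← hy, fibMul_gelfand]
  unfold ContinuousAt
  beta_reduce
  rw [h6]
  refine tendsto_nhds_gelfand_of_le c3.continuousAt (fun ef => ?_) h5
  rw [← norm_fibMul ef.2, ← norm_fibMul ef.2]
  refine le_trans (le_of_eq (congrArg norm ?_)) (norm_add_le _ _)
  rw [← fibMul_sub, fibMul_gelfand]

theorem continuous_fibStar (A B : C.Obj) : Continuous (fun e : TotalSpace ℂ (Fib A B) =>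
    (⟨_, fibStar e.snd⟩ : TotalSpace ℂ (Fib B A))) := by
  refine continuous_iff_continuousAt.2 fun ⟨p, e⟩ => ?_
  obtain ⟨x, rfl⟩ := gelfand_surjective e
  refine tendsto_nhds_gelfand (x := C.star x).2
    ⟨(continuous_inv.comp continuous_proj).continuousAt, ?_⟩
  refine (tendsto_norm_sub_gelfand x p).congr fun e => ?_
  rw [← norm_fibStar, fibStar_sub]
  rfl

/-- Equality of Gel'fand transforms in the total space. -/
theorem mk_gelfand_congr {p q : C.Spec A B} (h : p = q) {x y : C.Hom A B} (hxy : x = y) :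
    (⟨p, gelfand x p⟩ : TotalSpace ℂ (Fib A B)) = ⟨q, gelfand y q⟩ := by
  rw [h, hxy]

/-- Through ω the fibre algebra is ℂ, and the class of a becomes the number ω(a), the only point of
its spectrum. -/
theorem isPositive_gelfand (ω : Character C) {a : C.Hom A A} (ha : C.star a = a)
    (hre : 0 ≤ (ω.toFun a).re) (him : (ω.toFun a).im = 0)
    (h : src (mk ω (toFun_ne_zero_self ω A)) = tgt (mk ω (toFun_ne_zero_self ω A))) :
    C.spectrum.IsPositive (A := A) (p := mk ω (toFun_ne_zero_self ω A)) h (gelfand a _) := by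
  refine ⟨mk_gelfand_congr rfl ha, fun z hz => ?_⟩
  by_cases hzω : z = ω.toFun a
  · rw [hzω]; exact ⟨hre, him⟩
  · refine absurd ⟨gelfand ((z - ω.toFun a)⁻¹ • C.one A) _, ?_, ?_⟩ hz
    all_goals
      refine congrArg (TotalSpace.mk (F := ℂ) (E := Fib A A) (mk ω (toFun_ne_zero_self ω A)))
        ((Submodule.Quotient.eq _).2 ?_)
      change ω.toFun (C.comp _ _ - C.one A) = 0
      rw [map_sub, ω.map_comp, map_sub, map_smul, map_smul, ω.map_one]
      have := sub_ne_zero.2 hzω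
      simp only [smul_eq_mul, mul_one]
      field_simp
      simp

theorem isPositive_star_mul {p : C.Spec A B} (h : src (inv p) = tgt p)
    (h' : src (comp (inv p) p h) = tgt (comp (inv p) p h)) (e : Fib A B p) :
    C.spectrum.IsPositive (A := B) (p := comp (inv p) p h) h' (fibMul h (fibStar e) e) := by
  induction p using ind with
  | h ω hω =>
  obtain ⟨x, rfl⟩ := gelfand_surjective e
  exact isPositive_gelfand ω (a := C.comp (C.star x) x) (by rw [C.star_comp, C.star_star])
    (by rw [ω.toFun_star_comp, Complex.ofReal_re]; positivity)
    (by rw [ω.toFun_star_comp, Complex.ofReal_im]) h'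

/-- The product of two nonzero vectors is nonzero, as norms multiply, and the target fibre is a
line. -/
theorem span_fibMul {E : C.Obj} (p : C.Spec A B) (q : C.Spec B E) (h : src p = tgt q) :
    Submodule.span ℂ {g | ∃ (e : Fib A B p) (f : Fib B E q), g = fibMul h e f} = ⊤ := by
  have : Nontrivial (Fib A B p) := Module.nontrivial_of_finrank_eq_succ p.2
  have : Nontrivial (Fib B E q) := Module.nontrivial_of_finrank_eq_succ q.2
  obtain ⟨e, he⟩ := exists_ne (0 : Fib A B p)
  obtain ⟨f, hf⟩ := exists_ne (0 : Fib B E q)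
  have hef : fibMul h e f ≠ 0 := by
    rw [ne_eq, ← norm_eq_zero_iff, norm_fibMul, mul_eq_zero, norm_eq_zero_iff, norm_eq_zero_iff]
    exact not_or.2 ⟨he, hf⟩
  refine top_le_iff.1 (((finrank_eq_one_iff_of_nonzero _ hef).1 (comp p q h).2).ge.trans
    (Submodule.span_mono ?_))
  rintro _ rfl
  exact ⟨e, f, rfl⟩

end Spec

theorem isSpaceoid_spectrum (C : CStarCat.{u, v}) : C.spectrum.IsSpaceoid where
  toIsBase := isBase_spectrum C
  isBanachBundle := Spec.isBanachBundle
  isSectionSaturated A B := fun ⟨p, e⟩ => by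
    obtain ⟨x, rfl⟩ := Spec.gelfand_surjective e
    exact ⟨_, Spec.continuous_gelfand x, rfl⟩
  span_mul := Spec.span_fibMul
  rank_one p := p.2
  add_mul h e e' f := by
    obtain ⟨x, rfl⟩ := Spec.gelfand_surjective e
    obtain ⟨x', rfl⟩ := Spec.gelfand_surjective e'
    obtain ⟨y, rfl⟩ := Spec.gelfand_surjective f
    exact congrArg (fun a => Spec.gelfand a _) (C.add_comp x x' y)
  mul_add h e f f' := by
    obtain ⟨x, rfl⟩ := Spec.gelfand_surjective e
    obtain ⟨y, rfl⟩ := Spec.gelfand_surjective f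
    obtain ⟨y', rfl⟩ := Spec.gelfand_surjective f'
    exact congrArg (fun a => Spec.gelfand a _) (C.comp_add x y y')
  smul_mul h z e f := by
    obtain ⟨x, rfl⟩ := Spec.gelfand_surjective e
    obtain ⟨y, rfl⟩ := Spec.gelfand_surjective f
    exact congrArg (fun a => Spec.gelfand a _) (C.smul_comp z x y)
  mul_smul h z e f := by
    obtain ⟨x, rfl⟩ := Spec.gelfand_surjective e
    obtain ⟨y, rfl⟩ := Spec.gelfand_surjective f
    exact congrArg (fun a => Spec.gelfand a _) (C.comp_smul z x y)
  mul_assoc h₁ h₂ h₃ h₄ e f g := by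
    obtain ⟨x, rfl⟩ := Spec.gelfand_surjective e
    obtain ⟨y, rfl⟩ := Spec.gelfand_surjective f
    obtain ⟨z, rfl⟩ := Spec.gelfand_surjective g
    exact Spec.mk_gelfand_congr ((isBase_spectrum C).assoc _ _ _ h₁ h₂ h₃ h₄) (C.assoc x y z)
  one_mul h e := by
    obtain ⟨x, rfl⟩ := Spec.gelfand_surjective e
    exact Spec.mk_gelfand_congr ((isBase_spectrum C).tgt_comp_self _ h) (C.one_comp x)
  mul_one h e := by
    obtain ⟨x, rfl⟩ := Spec.gelfand_surjective e
    exact Spec.mk_gelfand_congr ((isBase_spectrum C).comp_src_self _ h) (C.comp_one x)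
  star_add := Spec.fibStar_add
  star_smul := Spec.fibStar_smul
  star_star e := by
    obtain ⟨x, rfl⟩ := Spec.gelfand_surjective e
    exact Spec.mk_gelfand_congr (Spec.inv_inv _) (C.star_star x)
  star_one {A} p := Spec.mk_gelfand_congr
    (Spec.tgt_injective ((Spec.tgt_inv p).trans ((Spec.src_self p).trans (Spec.tgt_self p).symm)))
    (C.star_one A)
  star_mul h h' e f := by
    obtain ⟨x, rfl⟩ := Spec.gelfand_surjective e
    obtain ⟨y, rfl⟩ := Spec.gelfand_surjective f
    exact Spec.mk_gelfand_congr (Spec.tgt_injective ((Spec.tgt_inv _).trans <|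
      (Spec.src_comp _ _ h).trans <| (Spec.tgt_inv _).symm.trans (Spec.tgt_comp _ _ h').symm))
      (C.star_comp x y)
  continuous_mul := Spec.continuous_fibMul
  continuous_star := Spec.continuous_fibStar
  continuous_one A := Spec.continuous_gelfand (C.one A)
  norm_mul_le h e f := (Spec.norm_fibMul h e f).le
  norm_star_mul h e := (Spec.norm_fibMul h _ _).trans
    ((congrArg (· * ‖e‖) (Spec.norm_fibStar e)).trans (sq _).symm)
  star_mul_pos := Spec.isPositive_star_mul

end CStarCat

/-! ### The morphisms Σ_φ -/

namespace CStarCat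

namespace Spec

variable {C D : CStarCat.{u, v}} {A B : C.Obj}

theorem fibMap_gelfand (φ : StarFunctor C D) (hφ : φ.IsNondegenerate)
    (p : D.Spec (φ.obj A) (φ.obj B)) (x : C.Hom A B) :
    fibMap φ hφ p (gelfand x (specMap φ hφ p)) = gelfand (φ.map x) p := rfl

/-- Both norms equal |ω(φ(x))|. -/
theorem norm_fibMap (φ : StarFunctor C D) (hφ : φ.IsNondegenerate)
    (p : D.Spec (φ.obj A) (φ.obj B)) (e : Fib A B (specMap φ hφ p)) :
    ‖fibMap φ hφ p e‖ = ‖e‖ := by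
  induction p using ind with
  | h ω hω =>
  obtain ⟨x, rfl⟩ := gelfand_surjective e
  rw [fibMap_gelfand, norm_gelfand_mk]
  exact (norm_gelfand_mk (ω.pullback φ) (hφ ω A B hω) x).symm

theorem continuous_fibMap (φ : StarFunctor C D) (hφ : φ.IsNondegenerate) (A B : C.Obj) :
    Continuous (fun e : TotalSpace ℂ (specMap φ hφ (A := A) (B := B) *ᵖ (Fib A B)) =>
      (⟨e.proj, fibMap φ hφ e.proj e.snd⟩ : TotalSpace ℂ (Fib (φ.obj A) (φ.obj B)))) := by
  refine continuous_iff_continuousAt.2 fun ⟨p, e⟩ => ?_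
  obtain ⟨x, rfl⟩ := gelfand_surjective (p := specMap φ hφ p) e
  refine tendsto_nhds_gelfand (x := φ.map x).2
    ⟨(Pullback.continuous_proj ℂ (Fib A B) (specMap φ hφ)).continuousAt, ?_⟩
  refine ((tendsto_norm_sub_gelfand x (specMap φ hφ p)).comp
    ((Pullback.continuous_lift ℂ (Fib A B) (specMap φ hφ)).tendsto ⟨p, _⟩)).congr fun e => ?_
  change ‖(show Fib A B (specMap φ hφ e.proj) from e.snd) - gelfand x (specMap φ hφ e.proj)‖ = _
  rw [← norm_fibMap, map_sub]
  rfl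

theorem specMap_comp (φ : StarFunctor C D) (hφ : φ.IsNondegenerate) {E : C.Obj}
    (p : D.Spec (φ.obj A) (φ.obj B)) (q : D.Spec (φ.obj B) (φ.obj E)) (h : src p = tgt q)
    (h' : src (specMap φ hφ p) = tgt (specMap φ hφ q)) :
    specMap φ hφ (comp p q h) = comp (specMap φ hφ p) (specMap φ hφ q) h' :=
  tgt_injective (by rw [← specMap_tgt, tgt_comp, tgt_comp, specMap_tgt])

/-- Serves when c lies over a point equal to q but not by definition: an equation in the total space
is enough to compute Λ^φ on a representative. Products, involutions and the functor laws all meet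
this situation. -/
theorem fibMap_eq_gelfand (φ : StarFunctor C D) (hφ : φ.IsNondegenerate)
    (p : D.Spec (φ.obj A) (φ.obj B)) (c : Fib A B (specMap φ hφ p)) {q : C.Spec A B}
    {x : C.Hom A B}
    (h : (⟨_, c⟩ : TotalSpace ℂ (Fib A B)) = ⟨q, gelfand x q⟩) :
    fibMap φ hφ p c = gelfand (φ.map x) p := by
  obtain ⟨rfl, h⟩ := TotalSpace.mk.inj h
  rw [eq_of_heq h, fibMap_gelfand]

theorem fibMap_fibMul (φ : StarFunctor C D) (hφ : φ.IsNondegenerate) {E : C.Obj}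
    (p : D.Spec (φ.obj A) (φ.obj B)) (q : D.Spec (φ.obj B) (φ.obj E)) (h : src p = tgt q)
    (h' : src (specMap φ hφ p) = tgt (specMap φ hφ q)) (a : Fib A B (specMap φ hφ p))
    (b : Fib B E (specMap φ hφ q)) (c : Fib A E (specMap φ hφ (comp p q h)))
    (hc : (⟨_, c⟩ : TotalSpace ℂ (Fib A E)) = ⟨_, fibMul h' a b⟩) :
    fibMap φ hφ _ c = fibMul h (fibMap φ hφ p a) (fibMap φ hφ q b) := by
  obtain ⟨x, rfl⟩ := gelfand_surjective a
  obtain ⟨y, rfl⟩ := gelfand_surjective b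
  rw [fibMap_eq_gelfand φ hφ _ c hc, φ.map_comp]
  rfl

theorem fibMap_fibStar (φ : StarFunctor C D) (hφ : φ.IsNondegenerate)
    (p : D.Spec (φ.obj A) (φ.obj B)) (a : Fib A B (specMap φ hφ p))
    (b : Fib B A (specMap φ hφ (inv p)))
    (hb : (⟨_, b⟩ : TotalSpace ℂ (Fib B A)) = ⟨_, fibStar a⟩) :
    fibMap φ hφ _ b = fibStar (fibMap φ hφ p a) := by
  obtain ⟨x, rfl⟩ := gelfand_surjective a
  rw [fibMap_eq_gelfand φ hφ _ b hb, φ.map_star]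
  rfl

end Spec

theorem isMorphism_spectrumMap {C D : CStarCat.{u, v}} (φ : StarFunctor C D)
    (hφ : φ.IsNondegenerate) : (spectrumMap φ hφ).IsMorphism where
  continuous_base _ _ := Spec.continuous_specMap φ hφ
  base_src p := by
    induction p using Spec.ind with
    | h ω hω => rfl
  base_tgt := Spec.specMap_tgt φ hφ
  base_comp := Spec.specMap_comp φ hφ
  base_inv p := by
    induction p using Spec.ind with
    | h ω hω => rfl
  base_infinity A B K hK := ⟨_, Spec.isCompact_preimage_specMap φ hφ hK, fun p hp => hp⟩
  continuous_fib := Spec.continuous_fibMap φ hφ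
  fib_one p := congrArg (fun a => Spec.gelfand a p) (φ.map_one _)
  fib_mul := Spec.fibMap_fibMul φ hφ
  fib_star := Spec.fibMap_fibStar φ hφ
  -- As Λ^φ is isometric, δ = ε and L = K suffice.
  fib_infinity A B ε hε K hK :=
    ⟨ε, hε, K, hK, fun p hp e he => ⟨hp, (Spec.norm_fibMap φ hφ p e).trans_lt he⟩⟩

end CStarCat

/-! ### Functoriality -/

/-- Two families of data with the same action on objects agree if their base maps agree and their
fibre maps agree on equal elements of the total space. -/
theorem SpaceoidData.HomData.ext_of_obj {S T : SpaceoidData.{u, v, w}} {obj : T.Ob ≃ S.Ob}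
    {base base' : ∀ {A B : T.Ob}, S.X (obj A) (obj B) → T.X A B}
    {fib : ∀ {A B : T.Ob} (p : S.X (obj A) (obj B)),
      T.E A B (base p) →ₗ[ℂ] S.E (obj A) (obj B) p}
    {fib' : ∀ {A B : T.Ob} (p : S.X (obj A) (obj B)),
      T.E A B (base' p) →ₗ[ℂ] S.E (obj A) (obj B) p}
    (hbase : ∀ {A B : T.Ob} (p : S.X (obj A) (obj B)), base p = base' p)
    (hfib : ∀ {A B : T.Ob} (p : S.X (obj A) (obj B)) (e : T.E A B (base p))
      (e' : T.E A B (base' p)), T.tot e = T.tot e' → fib p e = fib' p e') :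
    HomData.mk obj base fib = HomData.mk obj base' fib' := by
  -- The base maps are identified first: only then do the two families of fibre maps have the same
  -- type.
  have h : @base = @base' := by
    funext A B p
    exact hbase p
  subst h
  congr
  funext A B p
  exact LinearMap.ext fun e => hfib p e e rfl

end

theorem mainTheorem5 :
    ∃ (hobj : ∀ C : CommCStarCat.{u, v}, C.toCStarCat.spectrum.IsSpaceoid)
      (hmap : ∀ {C D : CommCStarCat.{u, v}} (φ : C ⟶ D),
        (CStarCat.spectrumMap φ.1 φ.2).IsMorphism)
      (S : CommCStarCat.{u, v}ᵒᵖ ⥤ Spaceoid.{u, v, max u v}),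
      S.toPrefunctor = spectrumPrefunctor hobj hmap := by
  have hobj (C : CommCStarCat.{u, v}) : C.toCStarCat.spectrum.IsSpaceoid :=
    CStarCat.isSpaceoid_spectrum _
  have hmap {C D : CommCStarCat.{u, v}} (φ : C ⟶ D) : (CStarCat.spectrumMap φ.1 φ.2).IsMorphism :=
    CStarCat.isMorphism_spectrumMap φ.1 φ.2
  refine ⟨hobj, hmap, { obj := (spectrumPrefunctor hobj hmap).obj,
                        map := (spectrumPrefunctor hobj hmap).map,
                        map_id := ?_, map_comp := ?_ }, rfl⟩
  · intro C
    refine Subtype.ext (SpaceoidData.HomData.ext_of_obj ?_ ?_)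
    · intro A B p
      induction p using CStarCat.Spec.ind with
      | h ω hω => rfl
    · intro A B p e e' h
      obtain ⟨x, rfl⟩ := CStarCat.Spec.gelfand_surjective e'
      -- With `e'` written as the transform of x, both sides are the class of x over p.
      exact CStarCat.Spec.fibMap_eq_gelfand _ _ p e h
  · intro C D E φ ψ
    refine Subtype.ext (SpaceoidData.HomData.ext_of_obj ?_ ?_)
    · intro A B p
      induction p using CStarCat.Spec.ind with
      | h ω hω => rfl
    · intro A B p e e' h
      obtain ⟨x, rfl⟩ := CStarCat.Spec.gelfand_surjective e'
      -- Both sides are the class over p of the image of x under the composite `*`-functor.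
      exact CStarCat.Spec.fibMap_eq_gelfand _ _ p e h
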